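/- \textbf{Setting.} Let $\gamma>-1$, $p\in[0,1)$, and let $(\mu_n)_{n\ge1}$ be a sequence of positive reals that is regularly varying of index $\gamma$, i.e. $\mu_{\lfloor \lambda n\rfloor}/\mu_n\to\lambda^\gamma$ as $n\to\infty$ for every $\lambda>0$. On a probability space let $(\xi_n)_{n\ge1}$ be i.i.d. real integrable random variables with $\mathbb E\,\xi_1=0$; let $(\alpha_n)_{n\ge2}$ be i.i.d. Bernoulli variables with parameter $p$; let $(\beta_n)_{n\ge2}$ be independent, with $\mathbb P(\beta_n=k)=\mu_k/\sum_{j=1}^{n-1}\mu_j$ for $1\le k\le n-1$; and let the three sequences $(\xi_n)$, $(\alpha_n)$, $(\beta_n)$ be independent of each other. Put $X_1=\xi_1$, $X_{n+1}=\alpha_{n+1}X_{\beta_{n+1}}+(1-\alpha_{n+1})\xi_{n+1}$ for $n\ge1$, and $S_n=\sum_{k=1}^nX_k$ (with $S_0=0$). Let $D([0,\infty))$ be the space of real functions on $[0,\infty)$ that are right continuous with left limits. For $x,y\in D([0,\infty))$ let $$d(x,y)=\sum_{m\ge1}2^{-m}\bigl(1\wedge d_m(g_mx,g_my)\bigr),$$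 where $g_m(t)=\max(0,\min(1,m-t))$ and $d_m(x,y)$ is the infimum of the $\varepsilon\ge0$ for which there is an increasing bijection $\tau$ of $[0,m]$ with $\bigl|\log\frac{\tau(t)-\tau(s)}{t-s}\bigr|\le\varepsilon$ for $0\le s<t\le m$ and $|x(t)-y(\tau(t))|\le\varepsilon$ for $0\le t\le m$. This is the Skorohod metric; its topology is the Skorohod topology and $\mathcal D$ is the Borel $\sigma$-field of that topology. \textbf{Theorem.} The processes $Y_n=\bigl(\tfrac1nS_{\lfloor nt\rfloor}\bigr)_{t\ge0}$, $n\ge 1$, are random elements of $(D([0,\infty)),\mathcal D)$. As $n\to\infty$ they converge to the zero process almost surely in the Skorohod topology, and in $L^1$; here convergence in $L^r$ means that $$\mathbb E\bigl[d(Y_n,0)^r\bigr]\to0\qquad\text{and}\qquad \mathbb E\Bigl[\sup_{0\le t\le T}|Y_n(t)|^r\Bigr]\to0\quad\text{for every }T\ge0.$$ If moreover $\mathbb E\,\xi_1^2<\infty$, then the convergence to the zero process also holds in $L^2$. -/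

import Mathlib

open MeasureTheory ProbabilityTheory Filter Topology
open scoped NNReal ENNReal

noncomputable section

/-- A sequence `(c n)` for `n ≥ 1` of positive reals is regularly varying of index `ρ` if
`c ⌊a n⌋ / c n → a ^ ρ` for every `a > 0`. The value `c 0` plays no role. -/
def IsRegularlyVarying (c : ℕ → ℝ) (ρ : ℝ) : Prop :=
  (∀ n, 1 ≤ n → 0 < c n) ∧
    ∀ a : ℝ, 0 < a → Tendsto (fun n : ℕ => c ⌊a * (n : ℝ)⌋₊ / c n) atTop (𝓝 (a ^ ρ))

/-- The steps `X n`, `n ≥ 1`, of a step reinforced walk along one realisation of the innovations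
`ξ`, of the recollection indicators `α` and of the recalled epochs `β`: `X 1 = ξ 1` and
`X n = α n * X (β n) + (1 - α n) * ξ n` for `n ≥ 2`, where `1 ≤ β n ≤ n - 1`.
(Values `β n ≥ n` and `β n = 0` have probability zero in the model; the term is then `0`.) -/
def reinforcedStep (ξ α : ℕ → ℝ) (β : ℕ → ℕ) : ℕ → ℝ
  | 0 => 0
  | 1 => ξ 1
  | n + 2 =>
      α (n + 2) * (if _h : β (n + 2) < n + 2 then reinforcedStep ξ α β (β (n + 2)) else 0)
        + (1 - α (n + 2)) * ξ (n + 2)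

/-- The position `S n = X 1 + ... + X n` of the walk. -/
def reinforcedWalk (ξ α : ℕ → ℝ) (β : ℕ → ℕ) (n : ℕ) : ℝ :=
  ∑ k ∈ Finset.Icc 1 n, reinforcedStep ξ α β k

/-- The space `D([0,∞))` of real functions on `[0,∞)` that are right continuous with left limits
(the condition on left limits is void at `0`). -/
@[ext]
structure SkorohodSpace where
  toFun : ℝ≥0 → ℝ
  right_continuous : ∀ t, ContinuousWithinAt toFun (Set.Ici t) t
  left_limit : ∀ t, ∃ l, Tendsto toFun (𝓝[<] t) (𝓝 l)

namespace SkorohodSpace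

instance : CoeFun SkorohodSpace (fun _ => ℝ≥0 → ℝ) := ⟨SkorohodSpace.toFun⟩

/-- The zero function. -/
instance : Zero SkorohodSpace :=
  ⟨⟨fun _ => 0, fun _ => continuousWithinAt_const, fun _ => ⟨0, tendsto_const_nhds⟩⟩⟩

/-- The (complete) Skorohod distance between two functions on `[0, T]`: the infimum of the `ε ≥ 0`
for which there is an increasing bijection `τ` of `[0, T]` with
`|log ((τ t - τ s) / (t - s))| ≤ ε` for `s < t`, and `|x t - y (τ t)| ≤ ε` for all `t`. -/
def distOn (T : ℝ≥0) (x y : ℝ≥0 → ℝ) : ℝ :=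
  sInf {ε : ℝ | 0 ≤ ε ∧ ∃ τ : Set.Icc (0 : ℝ≥0) T ≃o Set.Icc (0 : ℝ≥0) T,
    (∀ s t : Set.Icc (0 : ℝ≥0) T, s < t →
      |Real.log ((((τ t : ℝ≥0) : ℝ) - ((τ s : ℝ≥0) : ℝ)) /
        (((t : ℝ≥0) : ℝ) - ((s : ℝ≥0) : ℝ)))| ≤ ε) ∧
    ∀ t : Set.Icc (0 : ℝ≥0) T, |x (t : ℝ≥0) - y (τ t : ℝ≥0)| ≤ ε}

/-- The cut-off `g m`, equal to `1` on `[0, m - 1]`, to `m - t` on `[m - 1, m]`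
and to `0` on `[m, ∞)`. -/
def cutoff (m : ℕ) (t : ℝ≥0) : ℝ := max 0 (min 1 ((m : ℝ) - (t : ℝ)))

/-- The Skorohod metric on `D([0,∞))`: `∑_{m ≥ 1} 2 ^ (-m) * min 1 (d_m (g_m x, g_m y))`
where `d_m` is the Skorohod distance on `[0, m]`. -/
def skorohodDist (x y : SkorohodSpace) : ℝ :=
  ∑' m : ℕ, (1 / 2 : ℝ) ^ (m + 1) *
    min 1 (distOn ((m + 1 : ℕ) : ℝ≥0)
      (fun t => cutoff (m + 1) t * x t) (fun t => cutoff (m + 1) t * y t))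

/-- The Skorohod topology, that is, the topology of the metric `skorohodDist`. -/
instance : TopologicalSpace SkorohodSpace where
  IsOpen U := ∀ x ∈ U, ∃ ε : ℝ, 0 < ε ∧ ∀ y, skorohodDist x y < ε → y ∈ U
  isOpen_univ := fun _ _ => ⟨1, one_pos, fun _ _ => trivial⟩
  isOpen_inter := by
    rintro U V hU hV x ⟨hxU, hxV⟩
    obtain ⟨ε, hε, h⟩ := hU x hxU
    obtain ⟨δ, hδ, h'⟩ := hV x hxV
    exact ⟨min ε δ, lt_min hε hδ, fun y hy =>
      ⟨h y (hy.trans_le (min_le_left _ _)), h' y (hy.trans_le (min_le_right _ _))⟩⟩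
  isOpen_sUnion := by
    rintro 𝒰 h𝒰 x ⟨U, hU, hxU⟩
    obtain ⟨ε, hε, h⟩ := h𝒰 U hU x hxU
    exact ⟨ε, hε, fun y hy => ⟨U, hU, h y hy⟩⟩

/-- The Borel σ-field of the Skorohod topology. -/
instance : MeasurableSpace SkorohodSpace := borel SkorohodSpace

/-- The uniform distance on `[0, T]`. -/
def uniformEDist (T : ℝ≥0) (x y : SkorohodSpace) : ℝ≥0∞ :=
  ⨆ t : ℝ≥0, ⨆ _ : t ≤ T, ‖x t - y t‖ₑ

/-- The path `t ↦ s ⌊n t⌋ / n` as an element of `D([0,∞))` (the zero path for `n = 0`). -/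
def rescaledPath (s : ℕ → ℝ) (n : ℕ) : SkorohodSpace where
  toFun t := s ⌊(n : ℝ≥0) * t⌋₊ / (n : ℝ)
  right_continuous := by
    intro t
    have hc : Tendsto (fun u : ℝ≥0 => (n : ℝ≥0) * u) (𝓝[≥] t) (𝓝 ((n : ℝ≥0) * t)) :=
      ((continuous_const.mul continuous_id).tendsto t).mono_left nhdsWithin_le_nhds
    have h1 : ∀ᶠ u in 𝓝[≥] t, (n : ℝ≥0) * u < (⌊(n : ℝ≥0) * t⌋₊ : ℝ≥0) + 1 :=
      hc.eventually (gt_mem_nhds (Nat.lt_floor_add_one _))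
    refine Tendsto.congr' ?_ tendsto_const_nhds
    filter_upwards [h1, self_mem_nhdsWithin] with u hu htu
    have : ⌊(n : ℝ≥0) * u⌋₊ = ⌊(n : ℝ≥0) * t⌋₊ := by
      rw [Nat.floor_eq_iff zero_le]
      exact ⟨(Nat.floor_le zero_le).trans (mul_le_mul_right htu _), hu⟩
    simp only [this]
  left_limit := by
    intro t
    rcases Nat.eq_zero_or_pos n with rfl | hn
    · exact ⟨0, by simp only [Nat.cast_zero, div_zero]; exact tendsto_const_nhds⟩
    rcases eq_or_ne t 0 with rfl | ht
    · exact ⟨0, by simp⟩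
    have hn' : (0 : ℝ≥0) < n := by exact_mod_cast hn
    have hpos : 0 < (n : ℝ≥0) * t := mul_pos hn' (pos_iff_ne_zero.mpr ht)
    obtain ⟨k, hk⟩ : ∃ k, ⌈(n : ℝ≥0) * t⌉₊ = k + 1 :=
      Nat.exists_eq_succ_of_ne_zero (Nat.ceil_pos.mpr hpos).ne'
    have hkt : (k : ℝ≥0) < (n : ℝ≥0) * t := Nat.lt_ceil.mp (by omega)
    have htk : (n : ℝ≥0) * t ≤ (k : ℝ≥0) + 1 := by
      have := Nat.le_ceil ((n : ℝ≥0) * t)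
      rw [hk] at this
      exact_mod_cast this
    refine ⟨s k / n, ?_⟩
    have hc : Tendsto (fun u : ℝ≥0 => (n : ℝ≥0) * u) (𝓝[<] t) (𝓝 ((n : ℝ≥0) * t)) :=
      ((continuous_const.mul continuous_id).tendsto t).mono_left nhdsWithin_le_nhds
    refine Tendsto.congr' ?_ tendsto_const_nhds
    filter_upwards [hc.eventually (lt_mem_nhds hkt), self_mem_nhdsWithin] with u hu hut
    have : ⌊(n : ℝ≥0) * u⌋₊ = k := by
      rw [Nat.floor_eq_iff zero_le]
      exact ⟨hu.le, (mul_lt_mul_of_pos_left hut hn').trans_le htk⟩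
    simp only [this]

end SkorohodSpace

end

/-!
Write `X n` for the steps, `M n = μ 1 + ⋯ + μ n`, `y n = μ n / M n` and
`V n = (μ 1 * X 1 + ⋯ + μ n * X n) / M n`. Conditionally on the past, `X (n + 1)` is one of the
earlier steps, chosen according to `μ`, with probability `p`, and a new innovation with probability
`1 - p`; so its conditional mean is `p * V n`, and its law is that of an innovation.

*Strong law.* The steps being identically distributed and integrable, truncating `X n` at level
`n` changes only finitely many of them, almost surely, and `X (n + 1) = D n + p * V n + e n`, where
`D` is the sequence of martingale differences of the truncated steps and `e n → 0`. The truncated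
second moments divided by `n ^ 2` are summable, so `∑ w n * D n` converges almost surely for all
weights `w n = O(1 / n)` (`ae_tendsto_sum_noise`). The recursion
`V (n + 1) = (1 - (1 - p) * y (n + 1)) * V n + y (n + 1) * (D n + e n)` then forces `V n → 0`
(`tendsto_zero_of_stochastic_recursion`), and the same lemma with weights `1 / (n + 1)` gives
`S n / n → 0`.

About `μ` this uses only `y n = O(1 / n)` and `∑ y n = ∞`. The former follows from a local
uniformity of regular variation, which comes from the Baire category theorem
(`IsRegularlyVarying.exists_abs_log_sub_log_le`); the latter is the Abel–Dini theorem, since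
`M n → ∞` for an index above `-1`.

*Convergence of the paths.* `S n / n → 0` implies that the running maxima of `|S|` up to time `n T`
are `o(n)`; these dominate the uniform distance to the zero path, hence the Skorohod distance up to
`2 ^ (-T)`. The running maxima are dominated by averages of identically distributed variables, which
are uniformly integrable in `L^r` if the innovations are in `L^r`, so the convergence also holds in
`L^r` (`tendsto_eLpNorm_runningMax`). Measurability of the processes holds because the path depends
continuously on the positions of the walk.
-/

/-! ### Regularly varying sequences -/

noncomputable section

/-- **Local uniformity** of regular variation. The Baire category theorem makes the pointwise
convergence of `log (c ⌊exp s * n⌋ / c n)` to `s * ρ` uniform up to `ε` on a dense subset of some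
interval of `s`, and every index is met by such an `s`, since `⌊exp s * n⌋` is a step function. -/
lemma IsRegularlyVarying.exists_abs_log_sub_log_le {c : ℕ → ℝ} {ρ : ℝ}
    (h : IsRegularlyVarying c ρ) {ε : ℝ} (hε : 0 < ε) :
    ∃ r : ℝ, 1 < r ∧ ∃ N : ℕ, ∀ m m' : ℕ, N ≤ m → m ≤ m' → (m' : ℝ) ≤ r * m →
      |Real.log (c m') - Real.log (c m)| ≤ ε := by
  set g : ℕ → ℝ → ℝ := fun n s => Real.log (c ⌊Real.exp s * n⌋₊ / c n) with hg
  have hlim (s : ℝ) : Tendsto (fun n => g n s) atTop (𝓝 (s * ρ)) := by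
    have h1 := (h.2 (Real.exp s) (Real.exp_pos s)).log (by positivity)
    rwa [Real.log_rpow (Real.exp_pos s), Real.log_exp, mul_comm] at h1
  set F : ℕ → Set ℝ := fun N => {s | ∀ n, N ≤ n → |g n s - s * ρ| ≤ ε / 4} with hF
  have hcover : ⋃ N, closure (F N) = Set.univ := by
    refine Set.eq_univ_of_forall fun s => Set.mem_iUnion.2 ?_
    obtain ⟨N, hN⟩ := Metric.tendsto_atTop.1 (hlim s) (ε / 4) (by positivity)
    exact ⟨N, subset_closure fun n hn => (hN n hn).le⟩
  obtain ⟨N, s₀, hs₀⟩ := nonempty_interior_of_iUnion_of_closed (fun _ => isClosed_closure) hcover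
  obtain ⟨δ₀, hδ₀, hball⟩ := Metric.isOpen_iff.1 isOpen_interior s₀ hs₀
  obtain ⟨δ, hδ, hδ₁, hδ₂⟩ : ∃ δ : ℝ, 0 < δ ∧ δ ≤ δ₀ ∧ δ * |ρ| ≤ ε / 4 := by
    refine ⟨min δ₀ (ε / (4 * (|ρ| + 1))), lt_min hδ₀ (by positivity), min_le_left _ _, ?_⟩
    calc min δ₀ (ε / (4 * (|ρ| + 1))) * |ρ| ≤ ε / (4 * (|ρ| + 1)) * (|ρ| + 1) := by
          gcongr
          · exact min_le_right _ _
          · linarith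
      _ = ε / 4 := by field_simp
  have key (n m : ℕ) (hn : N + 1 ≤ n) (hm : 1 ≤ m) (h1 : Real.exp (s₀ - δ) * n ≤ m)
      (h2 : m < Real.exp (s₀ + δ) * n) :
      |Real.log (c m) - Real.log (c n) - s₀ * ρ| ≤ ε / 2 := by
    have hn0 : (0 : ℝ) < n := by exact_mod_cast (by omega : 0 < n)
    have hm0 : (0 : ℝ) < m := by exact_mod_cast hm
    have ha : s₀ - δ ≤ Real.log (m / n) := by
      rw [Real.le_log_iff_exp_le (by positivity), le_div_iff₀ hn0]; exact h1
    have hb : Real.log (m / n) < min (s₀ + δ) (Real.log ((m + 1) / n)) := by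
      refine lt_min ?_ (Real.log_lt_log (by positivity) (by gcongr; linarith))
      rw [Real.log_lt_iff_lt_exp (by positivity), div_lt_iff₀ hn0]; exact h2
    obtain ⟨t, ht₁, ht₂⟩ := exists_between hb
    have htF : t ∈ closure (F N) := by
      refine interior_subset (hball ?_)
      rw [Metric.mem_ball, Real.dist_eq, abs_lt]
      have := (lt_min_iff.1 ht₂).1
      constructor <;> linarith
    obtain ⟨s, ⟨hs₁, hs₂⟩, hsF⟩ := mem_closure_iff.1 htF (Set.Ioo _ _) isOpen_Ioo ⟨ht₁, ht₂⟩
    obtain ⟨hs₂, hs₃⟩ := lt_min_iff.1 hs₂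
    have hfloor : ⌊Real.exp s * n⌋₊ = m := by
      rw [Nat.floor_eq_iff (by positivity)]
      rw [Real.log_lt_iff_lt_exp (by positivity), div_lt_iff₀ hn0] at hs₁
      rw [Real.lt_log_iff_exp_lt (by positivity), lt_div_iff₀ hn0] at hs₃
      exact ⟨hs₁.le, hs₃⟩
    have h3 := hsF n (by omega)
    simp only [hg, hfloor] at h3
    rw [Real.log_div (h.1 m hm).ne' (h.1 n (by omega)).ne'] at h3
    have h4 : |s * ρ - s₀ * ρ| ≤ ε / 4 := by
      rw [← sub_mul, abs_mul]
      refine le_trans ?_ hδ₂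
      gcongr
      rw [abs_le]
      constructor <;> linarith
    calc _ = |(Real.log (c m) - Real.log (c n) - s * ρ) + (s * ρ - s₀ * ρ)| := by congr 1; ring
      _ ≤ _ := (abs_add_le _ _).trans (by linarith)
  -- Two indices `m ≤ m' ≤ exp δ * m` are compared through an `n` close to `exp (-(s₀ - δ)) * m`,
  -- for which both lie between `exp (s₀ - δ) * n` and `exp (s₀ + δ) * n`.
  set r := Real.exp δ with hr
  have hr1 : 1 < r := Real.one_lt_exp_iff.2 hδ
  have hrr : 0 < r * r - r := by nlinarith
  refine ⟨r, hr1, max 1 (max ⌈Real.exp (s₀ - δ) * (N + 2)⌉₊ ⌈Real.exp (s₀ + δ) / (r * r - r)⌉₊),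
    fun m m' hm hmm' hm' => ?_⟩
  simp only [max_le_iff, Nat.ceil_le] at hm
  obtain ⟨hm1, hmN, hmr⟩ := hm
  rw [div_le_iff₀ hrr] at hmr
  set n := ⌊Real.exp (-(s₀ - δ)) * m⌋₊ with hn
  have hee : Real.exp (s₀ - δ) * Real.exp (-(s₀ - δ)) = 1 := by rw [← Real.exp_add]; simp
  have hn1 : (n : ℝ) ≤ Real.exp (-(s₀ - δ)) * m := Nat.floor_le (by positivity)
  have hn2 : Real.exp (-(s₀ - δ)) * m < n + 1 := Nat.lt_floor_add_one _
  have hnN : N + 1 ≤ n := by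
    have h5 : Real.exp (-(s₀ - δ)) * (Real.exp (s₀ - δ) * (N + 2)) ≤ Real.exp (-(s₀ - δ)) * m := by
      gcongr
    have h6 : ((N + 2 : ℕ) : ℝ) < (n + 1 : ℕ) := by
      push_cast
      linear_combination h5 + hn2 - (N + 2) * hee
    have := Nat.cast_lt.1 h6
    omega
  have hlow : Real.exp (s₀ - δ) * n ≤ m := by
    calc _ ≤ Real.exp (s₀ - δ) * (Real.exp (-(s₀ - δ)) * m) := by gcongr
      _ = m := by rw [← mul_assoc, hee, one_mul]
  have hup : r * m < Real.exp (s₀ + δ) * n := by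
    have h7 : Real.exp (s₀ + δ) * Real.exp (-(s₀ - δ)) = r * r := by
      rw [← Real.exp_add, hr, ← Real.exp_add]; ring_nf
    have h8 := mul_lt_mul_of_pos_left hn2 (Real.exp_pos (s₀ + δ))
    rw [← mul_assoc, h7] at h8
    linarith
  have hmm : (m : ℝ) ≤ m' := by exact_mod_cast hmm'
  have hm0 : (0 : ℝ) ≤ m := by positivity
  have e1 := key n m hnN hm1 hlow (by nlinarith)
  have e2 := key n m' hnN (hm1.trans hmm') (hlow.trans hmm) (hm'.trans_lt hup)
  rw [abs_le] at e1 e2 ⊢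
  constructor <;> linarith [e1.1, e1.2, e2.1, e2.2]

/-- The part of Karamata's theorem saying that `n * c n` is at most of the order of
`c 1 + ... + c n`. -/
lemma IsRegularlyVarying.exists_mul_le_sum {c : ℕ → ℝ} {ρ : ℝ} (h : IsRegularlyVarying c ρ) :
    ∃ C : ℝ, ∀ n : ℕ, 1 ≤ n → n * c n ≤ C * ∑ j ∈ Finset.Icc 1 n, c j := by
  obtain ⟨r, hr, N, hN⟩ := h.exists_abs_log_sub_log_le one_pos
  have hr0 : 0 < r := by linarith
  have hr' : 0 < 1 - 1 / r := by rw [sub_pos, div_lt_one hr0]; exact hr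
  have hpos (n : ℕ) : ∀ j ∈ Finset.Icc 1 n, 0 ≤ c j := fun j hj =>
    (h.1 j (Finset.mem_Icc.1 hj).1).le
  refine ⟨r * (N + 1) + Real.exp 1 / (1 - 1 / r), fun n hn => ?_⟩
  have hM : 0 ≤ ∑ j ∈ Finset.Icc 1 n, c j := Finset.sum_nonneg (hpos n)
  have hE := Real.exp_pos 1
  have hcn := h.1 n hn
  rw [add_mul]
  rcases le_or_gt (n : ℝ) (r * (N + 1)) with hnr | hnr
  · have h1 : c n ≤ ∑ j ∈ Finset.Icc 1 n, c j :=
      Finset.single_le_sum (hpos n) (Finset.mem_Icc.2 ⟨hn, le_rfl⟩)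
    have h2 : n * c n ≤ r * (N + 1) * ∑ j ∈ Finset.Icc 1 n, c j := by gcongr
    have : 0 ≤ Real.exp 1 / (1 - 1 / r) * ∑ j ∈ Finset.Icc 1 n, c j := by positivity
    linarith
  · -- The indices between `n / r` and `n` already carry enough mass.
    have h1 : ∀ j ∈ Finset.Ioc ⌊(n : ℝ) / r⌋₊ n, c n / Real.exp 1 ≤ c j := by
      intro j hj
      obtain ⟨hj1, hj2⟩ := Finset.mem_Ioc.1 hj
      have hj3 : (n : ℝ) / r < j := (Nat.floor_lt (by positivity)).1 hj1
      rw [div_lt_iff₀ hr0] at hj3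
      have hjN : N ≤ j := by
        have : (N : ℝ) + 1 < j := by nlinarith
        have : N + 1 < j := by exact_mod_cast this
        omega
      have h2 := (abs_le.1 (hN j n hjN hj2 (by linarith))).2
      have hj0 := h.1 j (by omega)
      rw [← Real.log_div hcn.ne' hj0.ne', Real.log_le_iff_le_exp (by positivity),
        div_le_iff₀ hj0] at h2
      rw [div_le_iff₀ hE]
      linarith
    have h3 : (n : ℝ) * (1 - 1 / r) * (c n / Real.exp 1) ≤ ∑ j ∈ Finset.Icc 1 n, c j := by
      calc (n : ℝ) * (1 - 1 / r) * (c n / Real.exp 1)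
          ≤ ((Finset.Ioc ⌊(n : ℝ) / r⌋₊ n).card : ℝ) * (c n / Real.exp 1) := by
            gcongr
            have hle : ⌊(n : ℝ) / r⌋₊ ≤ n :=
              Nat.floor_le_of_le (div_le_self (by positivity) hr.le)
            rw [Nat.card_Ioc, Nat.cast_sub hle]
            have := Nat.floor_le (by positivity : 0 ≤ (n : ℝ) / r)
            linear_combination this
        _ ≤ ∑ j ∈ Finset.Ioc ⌊(n : ℝ) / r⌋₊ n, c j := by
            rw [← nsmul_eq_mul]; exact Finset.card_nsmul_le_sum _ _ _ h1
        _ ≤ _ := Finset.sum_le_sum_of_subset_of_nonneg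
            (fun j hj => by simp only [Finset.mem_Ioc, Finset.mem_Icc] at hj ⊢; omega)
            fun j hj _ => hpos n j hj
    have h4 : n * c n ≤ Real.exp 1 / (1 - 1 / r) * ∑ j ∈ Finset.Icc 1 n, c j := by
      rw [div_mul_eq_mul_div, le_div_iff₀ hr']
      calc n * c n * (1 - 1 / r) = Real.exp 1 * (n * (1 - 1 / r) * (c n / Real.exp 1)) := by
            field_simp
        _ ≤ _ := by gcongr
    have : 0 ≤ r * (N + 1) * ∑ j ∈ Finset.Icc 1 n, c j := by positivity
    linarith

/-- If `ρ > -1` then eventually `c (2 * n)` and `c (2 * n + 1)` are at least `c n / 2`, so that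
`n * c n` stays away from `0`, and the partial sums diverge like the harmonic series at least. -/
lemma IsRegularlyVarying.tendsto_sum_atTop {c : ℕ → ℝ} {ρ : ℝ} (h : IsRegularlyVarying c ρ)
    (hρ : -1 < ρ) : Tendsto (fun n => ∑ j ∈ Finset.range n, c (j + 1)) atTop atTop := by
  have h2ρ : (1 / 2 : ℝ) < 2 ^ ρ := by
    calc (1 / 2 : ℝ) = 2 ^ (-1 : ℝ) := by rw [Real.rpow_neg_one]; norm_num
      _ < 2 ^ ρ := Real.rpow_lt_rpow_of_exponent_lt (by norm_num) hρ
  obtain ⟨q, hq1, hq2⟩ := exists_between h2ρ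
  have hlog : 0 < Real.log (2 * q) := Real.log_pos (by linarith)
  obtain ⟨r, hr, N, hN⟩ := h.exists_abs_log_sub_log_le hlog
  obtain ⟨N', hN'⟩ := eventually_atTop.1
    ((h.2 2 two_pos).eventually (lt_mem_nhds hq2))
  set K := max (max N N') (⌈1 / (r - 1)⌉₊ + 1) with hK
  have hstep (n : ℕ) (hn : K ≤ n) : c n / 2 ≤ c (2 * n) ∧ c n / 2 ≤ c (2 * n + 1) := by
    have hn1 : 1 ≤ n := by omega
    have hcn := h.1 n hn1
    have hc2 := h.1 (2 * n) (by omega)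
    have e1 := hN' n (by omega)
    have hfl : ⌊(2 : ℝ) * n⌋₊ = 2 * n := by exact_mod_cast Nat.floor_natCast (R := ℝ) (2 * n)
    rw [hfl, lt_div_iff₀ hcn] at e1
    refine ⟨by nlinarith, ?_⟩
    have e2 := hN (2 * n) (2 * n + 1) (by omega) (by omega) (by
      have : (1 / (r - 1) : ℝ) ≤ n :=
        Nat.ceil_le.1 (by omega)
      rw [div_le_iff₀ (by linarith)] at this
      have h0 : (0 : ℝ) ≤ n * (r - 1) := mul_nonneg (by positivity) (by linarith)
      push_cast
      linarith)
    have e3 := (abs_le.1 e2).1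
    have hc3 := h.1 (2 * n + 1) (by omega)
    have e4 : Real.log (c (2 * n)) ≤ Real.log (2 * q * c (2 * n + 1)) := by
      rw [Real.log_mul (by linarith) hc3.ne']; linarith
    rw [Real.log_le_log_iff hc2 (by nlinarith)] at e4
    by_contra hcon
    push Not at hcon
    nlinarith
  obtain ⟨δ, hδ, hbase⟩ : ∃ δ : ℝ, 0 < δ ∧ ∀ n ∈ Finset.Icc 1 (2 * K), δ ≤ n * c n := by
    have hne : (Finset.Icc 1 (2 * K)).Nonempty := ⟨1, Finset.mem_Icc.2 ⟨le_rfl, by omega⟩⟩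
    obtain ⟨i, hi, hmin⟩ := Finset.exists_min_image _ (fun n : ℕ => (n : ℝ) * c n) hne
    have hi1 := (Finset.mem_Icc.1 hi).1
    exact ⟨i * c i, mul_pos (by exact_mod_cast hi1) (h.1 i hi1), hmin⟩
  have hlow (n : ℕ) (hn : 1 ≤ n) : δ ≤ n * c n := by
    induction n using Nat.strong_induction_on with
    | _ n ih =>
      rcases le_or_gt n (2 * K) with hnK | hnK
      · exact hbase n (Finset.mem_Icc.2 ⟨hn, hnK⟩)
      · obtain ⟨k, rfl | rfl⟩ := Nat.even_or_odd' n
        · have e1 := ih k (by omega) (by omega)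
          have e2 := mul_le_mul_of_nonneg_left (hstep k (by omega)).1 (Nat.cast_nonneg (α := ℝ) k)
          push_cast
          linarith
        · have e1 := ih k (by omega) (by omega)
          have e2 := mul_le_mul_of_nonneg_left (hstep k (by omega)).2 (Nat.cast_nonneg (α := ℝ) k)
          have e3 := h.1 (2 * k + 1) (by omega)
          push_cast
          linarith
  have hharm := Real.tendsto_sum_range_one_div_nat_succ_atTop.const_mul_atTop hδ
  refine tendsto_atTop_mono (fun n => ?_) hharm
  rw [Finset.mul_sum]
  refine Finset.sum_le_sum fun j _ => ?_
  have := hlow (j + 1) (by omega)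
  push_cast at this
  rw [mul_one_div, div_le_iff₀ (by positivity)]
  linarith

/-- The Abel–Dini theorem: the terms of a divergent positive series, divided by the partial sums,
still have a divergent sum. -/
lemma tendsto_sum_div_sum_atTop {f : ℕ → ℝ} (hf : ∀ n, 0 < f n)
    (h : Tendsto (fun n => ∑ j ∈ Finset.range n, f j) atTop atTop) :
    Tendsto (fun n => ∑ i ∈ Finset.range n, f i / ∑ j ∈ Finset.range (i + 1), f j)
      atTop atTop := by
  have hM (n : ℕ) : 0 < ∑ j ∈ Finset.range (n + 1), f j :=
    Finset.sum_pos (fun j _ => hf j) ⟨0, by simp⟩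
  rw [← not_summable_iff_tendsto_nat_atTop_of_nonneg fun i => (div_pos (hf i) (hM i)).le]
  intro hs
  obtain ⟨N, hN⟩ := Metric.tendsto_atTop.1 hs.hasSum.tendsto_sum_nat (1 / 4) (by norm_num)
  obtain ⟨m, hm, hNm⟩ := ((h.eventually_gt_atTop (2 * ∑ j ∈ Finset.range N, f j)).and
    (eventually_gt_atTop N)).exists
  have h1 := hN N le_rfl
  have h2 := hN m hNm.le
  rw [Real.dist_eq, abs_lt] at h1 h2
  have h3 : (∑ i ∈ Finset.range m, f i / ∑ j ∈ Finset.range (i + 1), f j)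
      - (∑ i ∈ Finset.range N, f i / ∑ j ∈ Finset.range (i + 1), f j) =
      ∑ i ∈ Finset.Ico N m, f i / ∑ j ∈ Finset.range (i + 1), f j :=
    (Finset.sum_Ico_eq_sub _ hNm.le).symm
  have h4 : (∑ i ∈ Finset.range m, f i) - ∑ i ∈ Finset.range N, f i =
      ∑ i ∈ Finset.Ico N m, f i := (Finset.sum_Ico_eq_sub _ hNm.le).symm
  have hMm : 0 < ∑ j ∈ Finset.range m, f j :=
    Finset.sum_pos (fun j _ => hf j) ⟨0, by simp; omega⟩
  have h5 : (∑ i ∈ Finset.Ico N m, f i) / ∑ j ∈ Finset.range m, f j ≤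
      ∑ i ∈ Finset.Ico N m, f i / ∑ j ∈ Finset.range (i + 1), f j := by
    rw [Finset.sum_div]
    refine Finset.sum_le_sum fun i hi => ?_
    have := Finset.mem_Ico.1 hi
    refine div_le_div_of_nonneg_left (hf i).le (hM i) ?_
    exact Finset.sum_le_sum_of_subset_of_nonneg (Finset.range_subset_range.2 (by omega))
      fun j _ _ => (hf j).le
  have h6 : (∑ i ∈ Finset.Ico N m, f i) / ∑ j ∈ Finset.range m, f j ≤ 1 / 2 := by
    linarith [h1.1, h1.2, h2.1, h2.2]
  rw [div_le_iff₀ hMm] at h6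
  linarith

/-! ### A recursion of stochastic approximation type -/

lemma tendsto_zero_of_contraction {u a e : ℕ → ℝ} (ha₀ : ∀ n, 0 ≤ a n) (ha₁ : ∀ n, a n ≤ 1)
    (ha : Tendsto (fun n => ∑ i ∈ Finset.range n, a i) atTop atTop)
    (he : Tendsto e atTop (𝓝 0)) (hu : ∀ n, u (n + 1) = (1 - a n) * u n + a n * e n) :
    Tendsto u atTop (𝓝 0) := by
  refine squeeze_zero_norm' (a := fun n => ‖u n‖) (.of_forall fun _ => le_rfl) ?_
  refine tendsto_order.2 ⟨fun b hb => .of_forall fun n => hb.trans_le (norm_nonneg _),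
    fun ε hε => ?_⟩
  obtain ⟨N, hN⟩ := Metric.tendsto_atTop.1 he (ε / 2) (by positivity)
  have hbound (n : ℕ) (hn : N ≤ n) : |u n| ≤ ε / 2 +
      |u N| * Real.exp (∑ i ∈ Finset.range N, a i - ∑ i ∈ Finset.range n, a i) := by
    induction n, hn using Nat.le_induction with
    | base => simp; positivity
    | succ n hn ih =>
      have he' : |e n| ≤ ε / 2 := by simpa [Real.dist_eq] using (hN n hn).le
      have h1 : 1 - a n ≤ Real.exp (-a n) := by linarith [Real.add_one_le_exp (-a n)]
      have hE := Real.exp_pos (∑ i ∈ Finset.range N, a i - ∑ i ∈ Finset.range n, a i)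
      calc |u (n + 1)| ≤ (1 - a n) * |u n| + a n * |e n| := by
            rw [hu]
            refine (abs_add_le _ _).trans (le_of_eq ?_)
            rw [abs_mul, abs_mul, abs_of_nonneg (ha₀ n), abs_of_nonneg (sub_nonneg.2 (ha₁ n))]
        _ ≤ (1 - a n) * (ε / 2 + |u N| *
              Real.exp (∑ i ∈ Finset.range N, a i - ∑ i ∈ Finset.range n, a i))
              + a n * (ε / 2) := by
            have := sub_nonneg.2 (ha₁ n)
            have := ha₀ n
            gcongr
        _ = ε / 2 + |u N| * ((1 - a n) *
              Real.exp (∑ i ∈ Finset.range N, a i - ∑ i ∈ Finset.range n, a i)) := by ring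
        _ ≤ ε / 2 + |u N| * (Real.exp (-a n) *
              Real.exp (∑ i ∈ Finset.range N, a i - ∑ i ∈ Finset.range n, a i)) := by gcongr
        _ = _ := by rw [← Real.exp_add, Finset.sum_range_succ]; ring_nf
  have hlim : Tendsto (fun n => ε / 2 + |u N| *
      Real.exp (∑ i ∈ Finset.range N, a i - ∑ i ∈ Finset.range n, a i)) atTop
      (𝓝 (ε / 2 + |u N| * 0)) := by
    refine ((Real.tendsto_exp_atBot.comp ?_).const_mul _).const_add _
    exact tendsto_atBot_add_const_left _ _ (tendsto_neg_atTop_atBot.comp ha)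
  filter_upwards [hlim.eventually (gt_mem_nhds (show ε / 2 + |u N| * 0 < ε by linarith)),
    eventually_ge_atTop N] with n h1 h2
  exact (hbound n h2).trans_lt h1

/-- With weights `y n` of divergent sum, a recursion that averages noise whose weighted series
converges and errors that vanish is driven to `0`. Kronecker's lemma is the case `e = 0`, `c = 1`,
`y n = 1 / (n + 1)`. -/
lemma tendsto_zero_of_stochastic_recursion {v y D e : ℕ → ℝ} {c R : ℝ} (hc : 0 < c)
    (hy₀ : ∀ n, 0 ≤ y n) (hy₁ : ∀ n, c * y n ≤ 1)
    (hy : Tendsto (fun n => ∑ i ∈ Finset.range n, y i) atTop atTop)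
    (hD : Tendsto (fun n => ∑ i ∈ Finset.range n, y i * D i) atTop (𝓝 R))
    (he : Tendsto e atTop (𝓝 0))
    (hv : ∀ n, v (n + 1) = (1 - c * y n) * v n + y n * (D n + e n)) :
    Tendsto v atTop (𝓝 0) := by
  -- Adding the remainder of the noise series to `v` removes the noise from the recursion.
  set ρ : ℕ → ℝ := fun n => R - ∑ i ∈ Finset.range n, y i * D i with hρ
  have hρ0 : Tendsto ρ atTop (𝓝 0) := by simpa using hD.const_sub R
  have h := tendsto_zero_of_contraction (u := fun n => v n + ρ n) (a := fun n => c * y n)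
    (e := fun n => e n / c + ρ n) (fun n => mul_nonneg hc.le (hy₀ n)) hy₁
    (by simpa [Finset.mul_sum] using hy.const_mul_atTop hc)
    (by simpa using (he.div_const c).add hρ0)
    (fun n => by
      simp only [hρ, Finset.sum_range_succ, hv]
      field_simp
      ring)
  simpa using h.sub hρ0

lemma sum_Icc_one_eq_sum_range (f : ℕ → ℝ) (n : ℕ) :
    ∑ j ∈ Finset.Icc 1 n, f j = ∑ j ∈ Finset.range n, f (j + 1) := by
  induction n with
  | zero => simp
  | succ n ih => rw [Finset.sum_Icc_succ_top (by omega), ih, Finset.sum_range_succ]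

/-- Along one realisation: if each step is noise plus `p` times the `μ`-weighted average of the
preceding steps plus a vanishing error, and both weighted noise series converge, then the
averages of the steps vanish. -/
lemma tendsto_average_zero_of_reinforcement {x μ D : ℕ → ℝ} {p R R' : ℝ}
    (hp₀ : 0 ≤ p) (hp₁ : p < 1) (hμ : ∀ n, 1 ≤ n → 0 < μ n)
    (hdiv : Tendsto (fun n => ∑ j ∈ Finset.range n, μ (j + 1)) atTop atTop)
    (hD : Tendsto (fun n => ∑ i ∈ Finset.range n,
      μ (i + 1) / (∑ j ∈ Finset.Icc 1 (i + 1), μ j) * D i) atTop (𝓝 R))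
    (hD' : Tendsto (fun n => ∑ i ∈ Finset.range n, 1 / ((i : ℝ) + 1) * D i) atTop (𝓝 R'))
    (he : Tendsto (fun n => x (n + 1) - D n -
      p * ((∑ j ∈ Finset.Icc 1 n, μ j * x j) / ∑ j ∈ Finset.Icc 1 n, μ j)) atTop (𝓝 0)) :
    Tendsto (fun n : ℕ => (∑ j ∈ Finset.Icc 1 n, x j) / n) atTop (𝓝 0) := by
  set M : ℕ → ℝ := fun n => ∑ j ∈ Finset.Icc 1 n, μ j with hM
  set V : ℕ → ℝ := fun n => (∑ j ∈ Finset.Icc 1 n, μ j * x j) / M n with hV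
  have hMpos (n : ℕ) : 0 < M (n + 1) :=
    Finset.sum_pos (fun j hj => hμ j (Finset.mem_Icc.1 hj).1) ⟨1, by simp⟩
  have hMs (n : ℕ) : M (n + 1) = M n + μ (n + 1) := Finset.sum_Icc_succ_top (by omega) _
  have hMn (n : ℕ) : 0 ≤ M n :=
    Finset.sum_nonneg fun j hj => (hμ j (Finset.mem_Icc.1 hj).1).le
  have hy : Tendsto (fun n => ∑ i ∈ Finset.range n, μ (i + 1) / M (i + 1)) atTop atTop := by
    have := tendsto_sum_div_sum_atTop (f := fun n => μ (n + 1)) (fun n => hμ _ (by omega)) hdiv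
    simpa only [hM, sum_Icc_one_eq_sum_range] using this
  have hy₁ (n : ℕ) : μ (n + 1) / M (n + 1) ≤ 1 := by
    rw [div_le_one (hMpos n), hMs]; linarith [hMn n]
  have hVlim : Tendsto V atTop (𝓝 0) := by
    refine tendsto_zero_of_stochastic_recursion (c := 1 - p) (y := fun n => μ (n + 1) / M (n + 1))
      (by linarith) (fun n => (div_pos (hμ _ (by omega)) (hMpos n)).le)
      (fun n => ?_) hy hD he fun n => ?_
    · have h0 : 0 ≤ μ (n + 1) / M (n + 1) := (div_pos (hμ _ (by omega)) (hMpos n)).le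
      nlinarith [hy₁ n]
    · -- This includes `n = 0`, where the weighted average is `0 / 0 = 0` and the sum is empty.
      have hW : M n * V n = ∑ j ∈ Finset.Icc 1 n, μ j * x j := by
        rcases n with _ | n
        · simp [hM]
        · exact mul_div_cancel₀ _ (hMpos n).ne'
      have hrec : V (n + 1) = (M n * V n + μ (n + 1) * x (n + 1)) / M (n + 1) := by
        rw [hW, hV]
        simp only
        rw [Finset.sum_Icc_succ_top (by omega)]
      rw [hrec]
      have hne := (hMpos n).ne'
      change _ = (1 - (1 - p) * (μ (n + 1) / M (n + 1))) * V n +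
        μ (n + 1) / M (n + 1) * (D n + (x (n + 1) - D n - p * V n))
      field_simp
      rw [hMs]
      ring
  refine tendsto_zero_of_stochastic_recursion (c := 1) (y := fun n => 1 / ((n : ℝ) + 1))
    (e := fun n => (x (n + 1) - D n - p * V n) + p * V n)
    one_pos (fun n => by positivity) (fun n => ?_)
    (by simpa using Real.tendsto_sum_range_one_div_nat_succ_atTop) hD'
    (by simpa only [mul_zero, add_zero] using he.add (hVlim.const_mul p)) fun n => ?_
  · rw [one_mul, div_le_one (by positivity)]
    linarith [(Nat.cast_nonneg n : (0 : ℝ) ≤ n)]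
  · rw [Finset.sum_Icc_succ_top (by omega)]
    rcases n with _ | n
    · simp
    · push_cast
      field_simp
      ring

/-! ### Running maxima and the Skorohod distance to the zero path -/

/-- The running maximum `max (|s 0|, ..., |s N|)`. -/
def runningMax (s : ℕ → ℝ) (N : ℕ) : ℝ :=
  (Finset.range (N + 1)).sup' Finset.nonempty_range_add_one fun m => |s m|

lemma abs_le_runningMax (s : ℕ → ℝ) {m N : ℕ} (h : m ≤ N) : |s m| ≤ runningMax s N :=
  Finset.le_sup' (fun m => |s m|) (Finset.mem_range.2 (by omega))

lemma runningMax_nonneg (s : ℕ → ℝ) (N : ℕ) : 0 ≤ runningMax s N :=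
  (abs_nonneg _).trans (abs_le_runningMax s (Nat.zero_le N))

lemma runningMax_le {s : ℕ → ℝ} {N : ℕ} {B : ℝ} (h : ∀ m ≤ N, |s m| ≤ B) : runningMax s N ≤ B :=
  Finset.sup'_le _ _ fun m hm => h m (by have := Finset.mem_range.1 hm; omega)

lemma tendsto_runningMax_div {s : ℕ → ℝ} (h : Tendsto (fun n : ℕ => s n / n) atTop (𝓝 0))
    (T : ℝ≥0) : Tendsto (fun n : ℕ => runningMax s ⌊(n : ℝ≥0) * T⌋₊ / n) atTop (𝓝 0) := by
  refine tendsto_order.2 ⟨fun b hb => .of_forall fun n =>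
    hb.trans_le (div_nonneg (runningMax_nonneg _ _) (Nat.cast_nonneg n)), fun ε hε => ?_⟩
  set η : ℝ := ε / (2 * (T + 1)) with hη
  have hη0 : 0 < η := by positivity
  have hηT : η * T ≤ ε / 2 := by
    calc η * T ≤ η * (T + 1) := by gcongr; linarith
      _ = ε / 2 := by rw [hη]; field_simp
  obtain ⟨N, hN⟩ := Metric.tendsto_atTop.1 h η hη0
  have hlin (m : ℕ) : |s m| ≤ runningMax s N + η * m := by
    rcases le_total m N with hm | hm
    · have := abs_le_runningMax s hm
      have : 0 ≤ η * m := by positivity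
      linarith
    · rcases Nat.eq_zero_or_pos m with rfl | hm0
      · simpa using abs_le_runningMax s (Nat.zero_le N)
      · have h1 := (hN m hm).le
        have hm0' : (0 : ℝ) < m := by exact_mod_cast hm0
        rw [Real.dist_eq, sub_zero, abs_div, Nat.abs_cast, div_le_iff₀ hm0'] at h1
        linarith [runningMax_nonneg s N]
  have hlim : Tendsto (fun n : ℕ => runningMax s N / (n : ℝ)) atTop (𝓝 0) :=
    tendsto_const_div_atTop_nhds_zero_nat _
  filter_upwards [hlim.eventually (gt_mem_nhds (half_pos hε)), eventually_gt_atTop 0] with n h1 h2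
  have hn : (0 : ℝ) < n := by exact_mod_cast h2
  have hfl : ((⌊(n : ℝ≥0) * T⌋₊ : ℕ) : ℝ) ≤ n * T := by
    exact_mod_cast Nat.floor_le (zero_le (a := (n : ℝ≥0) * T))
  calc runningMax s ⌊(n : ℝ≥0) * T⌋₊ / n ≤ (runningMax s N + η * (n * T)) / n := by
        gcongr
        refine runningMax_le fun m hm => (hlin m).trans ?_
        have : (m : ℝ) ≤ (⌊(n : ℝ≥0) * T⌋₊ : ℕ) := by exact_mod_cast hm
        gcongr
        exact this.trans hfl
    _ = runningMax s N / n + η * T := by field_simp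
    _ < ε := by linarith

namespace SkorohodSpace

lemma cutoff_nonneg (m : ℕ) (t : ℝ≥0) : 0 ≤ cutoff m t := le_max_left _ _

lemma cutoff_le_one (m : ℕ) (t : ℝ≥0) : cutoff m t ≤ 1 := max_le zero_le_one (min_le_left _ _)

lemma distOn_nonneg (T : ℝ≥0) (x y : ℝ≥0 → ℝ) : 0 ≤ distOn T x y :=
  Real.sInf_nonneg fun _ h => h.1

/-- Without a change of time, the Skorohod distance is the uniform one. -/
lemma distOn_le {T : ℝ≥0} {x y : ℝ≥0 → ℝ} {B : ℝ} (hB : 0 ≤ B) (h : ∀ t ≤ T, |x t - y t| ≤ B) :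
    distOn T x y ≤ B := by
  refine csInf_le ⟨0, fun _ h => h.1⟩ ⟨hB, OrderIso.refl _, fun s t hst => ?_, fun t => h t t.2.2⟩
  have : ((t : ℝ≥0) : ℝ) - ((s : ℝ≥0) : ℝ) ≠ 0 :=
    sub_ne_zero.2 (NNReal.coe_lt_coe.2 (Subtype.coe_lt_coe.2 hst)).ne'
  simpa [div_self this] using hB

lemma skorohodDist_nonneg (x y : SkorohodSpace) : 0 ≤ skorohodDist x y :=
  tsum_nonneg fun _ => mul_nonneg (by positivity) (le_min zero_le_one (distOn_nonneg _ _ _))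

/-- The Skorohod distance is controlled by the uniform distance on `[0, M]`, up to the weight of
the terms that see times after `M`. -/
lemma skorohodDist_le {x y : SkorohodSpace} (M : ℕ) {B : ℝ} (hB : 0 ≤ B)
    (h : ∀ t ≤ (M : ℝ≥0), |x t - y t| ≤ B) : skorohodDist x y ≤ B + (1 / 2) ^ M := by
  set a : ℕ → ℝ := fun m => min 1 (distOn ((m + 1 : ℕ) : ℝ≥0)
      (fun t => cutoff (m + 1) t * x t) (fun t => cutoff (m + 1) t * y t)) with ha
  have ha0 (m : ℕ) : 0 ≤ a m := le_min zero_le_one (distOn_nonneg _ _ _)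
  have ha1 (m : ℕ) : a m ≤ 1 := min_le_left _ _
  have haB (m : ℕ) (hm : m < M) : a m ≤ B := by
    refine (min_le_right _ _).trans (distOn_le hB fun t ht => ?_)
    rw [← mul_sub, abs_mul, abs_of_nonneg (cutoff_nonneg _ _)]
    have h1 := h t (ht.trans (by exact_mod_cast hm))
    have h2 := mul_le_mul (cutoff_le_one (m + 1) t) h1 (abs_nonneg _) zero_le_one
    linarith
  have hgeom : Summable fun m : ℕ => (1 / 2 : ℝ) ^ (m + 1) :=
    (summable_nat_add_iff 1).2 summable_geometric_two
  have hgeom1 : ∑' m : ℕ, (1 / 2 : ℝ) ^ (m + 1) = 1 := by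
    simp only [pow_succ, tsum_mul_right, tsum_geometric_two]; norm_num
  have hsum : Summable fun m => (1 / 2 : ℝ) ^ (m + 1) * a m :=
    Summable.of_nonneg_of_le (fun m => mul_nonneg (by positivity) (ha0 m))
      (fun m => mul_le_of_le_one_right (by positivity) (ha1 m)) hgeom
  change ∑' m, (1 / 2 : ℝ) ^ (m + 1) * a m ≤ _
  rw [← hsum.sum_add_tsum_nat_add M]
  refine add_le_add ?_ ?_
  · calc ∑ m ∈ Finset.range M, (1 / 2 : ℝ) ^ (m + 1) * a m
        ≤ ∑ m ∈ Finset.range M, (1 / 2 : ℝ) ^ (m + 1) * B :=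
          Finset.sum_le_sum fun m hm => by
            have := haB m (Finset.mem_range.1 hm)
            gcongr
      _ = (∑ m ∈ Finset.range M, (1 / 2 : ℝ) ^ (m + 1)) * B := by rw [Finset.sum_mul]
      _ ≤ 1 * B := by
          gcongr
          exact (hgeom.sum_le_tsum _ fun _ _ => by positivity).trans hgeom1.le
      _ = B := one_mul B
  · calc ∑' m : ℕ, (1 / 2 : ℝ) ^ (m + M + 1) * a (m + M)
        ≤ ∑' m : ℕ, (1 / 2 : ℝ) ^ M * (1 / 2 : ℝ) ^ (m + 1) := by
          refine ((summable_nat_add_iff M).2 hsum).tsum_le_tsum (fun m => ?_) (hgeom.mul_left _)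
          calc (1 / 2 : ℝ) ^ (m + M + 1) * a (m + M) ≤ (1 / 2 : ℝ) ^ (m + M + 1) :=
                mul_le_of_le_one_right (by positivity) (ha1 _)
            _ = (1 / 2 : ℝ) ^ M * (1 / 2 : ℝ) ^ (m + 1) := by ring
      _ = (1 / 2) ^ M := by rw [tsum_mul_left, hgeom1, mul_one]

lemma abs_rescaledPath_le (s : ℕ → ℝ) (n : ℕ) {t T : ℝ≥0} (ht : t ≤ T) :
    |rescaledPath s n t| ≤ runningMax s ⌊(n : ℝ≥0) * T⌋₊ / n := by
  change |s ⌊(n : ℝ≥0) * t⌋₊ / (n : ℝ)| ≤ _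
  rw [abs_div, Nat.abs_cast]
  gcongr
  exact abs_le_runningMax s (Nat.floor_mono (by gcongr))

lemma skorohodDist_rescaledPath_le (s : ℕ → ℝ) (n M : ℕ) :
    skorohodDist (rescaledPath s n) 0 ≤
      runningMax s ⌊(n : ℝ≥0) * (M : ℝ≥0)⌋₊ / n + (1 / 2) ^ M := by
  refine skorohodDist_le M (div_nonneg (runningMax_nonneg _ _) (Nat.cast_nonneg n)) fun t ht => ?_
  rw [show (0 : SkorohodSpace) t = 0 from rfl, sub_zero]
  exact abs_rescaledPath_le s n ht

lemma skorohodDist_zero_rescaledPath_le (s : ℕ → ℝ) (n M : ℕ) :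
    skorohodDist 0 (rescaledPath s n) ≤
      runningMax s ⌊(n : ℝ≥0) * (M : ℝ≥0)⌋₊ / n + (1 / 2) ^ M := by
  refine skorohodDist_le M (div_nonneg (runningMax_nonneg _ _) (Nat.cast_nonneg n)) fun t ht => ?_
  rw [show (0 : SkorohodSpace) t = 0 from rfl, zero_sub, abs_neg]
  exact abs_rescaledPath_le s n ht

lemma uniformEDist_rescaledPath_le (s : ℕ → ℝ) (n : ℕ) (T : ℝ≥0) :
    uniformEDist T (rescaledPath s n) 0 ≤
      ENNReal.ofReal (runningMax s ⌊(n : ℝ≥0) * T⌋₊ / n) := by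
  refine iSup₂_le fun t ht => ?_
  rw [show (0 : SkorohodSpace) t = 0 from rfl, sub_zero, Real.enorm_eq_ofReal_abs]
  exact ENNReal.ofReal_le_ofReal (abs_rescaledPath_le s n ht)

lemma tendsto_nhds_of_skorohodDist {x : SkorohodSpace} {y : ℕ → SkorohodSpace}
    (h : Tendsto (fun n => skorohodDist x (y n)) atTop (𝓝 0)) : Tendsto y atTop (𝓝 x) := by
  rw [tendsto_nhds]
  intro U hU hxU
  obtain ⟨ε, hε, hUε⟩ := hU x hxU
  filter_upwards [h.eventually (gt_mem_nhds hε)] with n hn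
  exact hUε _ hn

lemma tendsto_rescaledPath {s : ℕ → ℝ} (h : Tendsto (fun n : ℕ => s n / n) atTop (𝓝 0)) :
    Tendsto (fun n => rescaledPath s n) atTop (𝓝 0) := by
  refine tendsto_nhds_of_skorohodDist (tendsto_order.2 ⟨fun b hb => .of_forall fun n =>
    hb.trans_le (skorohodDist_nonneg _ _), fun ε hε => ?_⟩)
  obtain ⟨M, hM⟩ := exists_pow_lt_of_lt_one (half_pos hε) (by norm_num : (1 / 2 : ℝ) < 1)
  filter_upwards [(tendsto_runningMax_div h M).eventually (gt_mem_nhds (half_pos hε))] with n hn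
  linarith [skorohodDist_zero_rescaledPath_le s n M]

/-- The path depends continuously on the positions: up to a fixed time it involves only finitely
many of them. -/
lemma continuous_rescaledPath (n : ℕ) : Continuous fun s : ℕ → ℝ => rescaledPath s n := by
  rw [continuous_def]
  intro U hU
  rw [isOpen_iff_mem_nhds]
  intro s hs
  obtain ⟨ε, hε, hUε⟩ := hU _ hs
  obtain ⟨M, hM⟩ := exists_pow_lt_of_lt_one (half_pos hε) (by norm_num : (1 / 2 : ℝ) < 1)
  set K := ⌊(n : ℝ≥0) * (M : ℝ≥0)⌋₊ with hK
  have hev : ∀ᶠ s' in 𝓝 s, ∀ m ∈ Finset.range (K + 1), |s m - s' m| < ε / 2 := by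
    rw [Finset.eventually_all]
    intro m _
    have hc : Tendsto (fun s' : ℕ → ℝ => |s m - s' m|) (𝓝 s) (𝓝 |s m - s m|) :=
      (continuous_const.sub (continuous_apply m)).abs.tendsto s
    rw [sub_self, abs_zero] at hc
    exact hc.eventually (gt_mem_nhds (half_pos hε))
  filter_upwards [hev] with s' hs'
  refine hUε _ ((skorohodDist_le M (half_pos hε).le fun t ht => ?_).trans_lt (by linarith))
  change |s ⌊(n : ℝ≥0) * t⌋₊ / (n : ℝ) - s' ⌊(n : ℝ≥0) * t⌋₊ / (n : ℝ)| ≤ _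
  have h1 : ⌊(n : ℝ≥0) * t⌋₊ ≤ K := Nat.floor_mono (by gcongr)
  rcases Nat.eq_zero_or_pos n with rfl | hn
  · simpa using (half_pos hε).le
  · rw [← sub_div, abs_div, Nat.abs_cast]
    refine (div_le_self (abs_nonneg _) (by exact_mod_cast hn)).trans (hs' _ ?_).le
    exact Finset.mem_range.2 (by omega)

lemma measurable_rescaledPath (n : ℕ) : Measurable fun s : ℕ → ℝ => rescaledPath s n := by
  have : BorelSpace SkorohodSpace := ⟨rfl⟩
  exact (continuous_rescaledPath n).measurable

end SkorohodSpace

/-! ### Independence and martingales -/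

lemma iIndep_sumElim {Ω ι κ : Type*} [MeasurableSpace Ω] {P : Measure Ω}
    {m₁ : ι → MeasurableSpace Ω} {m₂ : κ → MeasurableSpace Ω}
    (h₁ : iIndep m₁ P) (h₂ : iIndep m₂ P) (h : Indep (⨆ i, m₁ i) (⨆ j, m₂ j) P) :
    iIndep (Sum.elim m₁ m₂) P := by
  rw [iIndep_iff]
  intro s f hf
  have hl : ∀ i ∈ s.toLeft, MeasurableSet[m₁ i] (f (Sum.inl i)) := fun i hi =>
    hf _ (Finset.mem_toLeft.1 hi)
  have hr : ∀ j ∈ s.toRight, MeasurableSet[m₂ j] (f (Sum.inr j)) := fun j hj =>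
    hf _ (Finset.mem_toRight.1 hj)
  have hsplit : ⋂ i ∈ s, f i =
      (⋂ i ∈ s.toLeft, f (Sum.inl i)) ∩ ⋂ j ∈ s.toRight, f (Sum.inr j) := by
    ext ω
    simp
  rw [hsplit, Finset.prod_sum_eq_prod_toLeft_mul_prod_toRight, ← h₁.meas_biInter hl,
    ← h₂.meas_biInter hr]
  refine (Indep_iff _ _ _).1 h _ _ ?_ ?_
  · exact @Finset.measurableSet_biInter _ _ (⨆ i, m₁ i) _ _ fun i hi =>
      le_iSup m₁ i _ (hl i hi)
  · exact @Finset.measurableSet_biInter _ _ (⨆ j, m₂ j) _ _ fun j hj =>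
      le_iSup m₂ j _ (hr j hj)

lemma iSup_comap_le_comap_pi {Ω ι E : Type*} [MeasurableSpace E] (f : ι → Ω → E) :
    ⨆ i, MeasurableSpace.comap (f i) inferInstance ≤
      MeasurableSpace.comap (fun ω i => f i ω) inferInstance := by
  refine iSup_le fun i => ?_
  rintro _ ⟨s, hs, rfl⟩
  exact ⟨_, measurable_pi_apply i hs, rfl⟩

/-- **Convergence of square-integrable martingales**, for their increments. -/
lemma ae_tendsto_sum_of_condExp_eq_zero {Ω : Type*} [m0 : MeasurableSpace Ω] {P : Measure Ω}
    [IsProbabilityMeasure P] {F : Filtration ℕ m0} {D : ℕ → Ω → ℝ}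
    (hDm : ∀ n, StronglyMeasurable[F (n + 1)] (D n)) (hD2 : ∀ n, MemLp (D n) 2 P)
    (hD0 : ∀ n, P[D n | F n] =ᵐ[P] 0) (hsum : Summable fun n => ∫ ω, D n ω ^ 2 ∂P) :
    ∀ᵐ ω ∂P, ∃ R, Tendsto (fun n => ∑ i ∈ Finset.range n, D i ω) atTop (𝓝 R) := by
  set N : ℕ → Ω → ℝ := fun n ω => ∑ i ∈ Finset.range n, D i ω with hN
  have hNs (n : ℕ) : N (n + 1) = N n + D n := by ext ω; simp [hN, Finset.sum_range_succ]
  have hNm (n : ℕ) : StronglyMeasurable[F n] (N n) := by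
    induction n with
    | zero => simp only [hN, Finset.range_zero, Finset.sum_empty]; exact stronglyMeasurable_const
    | succ n ih => rw [hNs]; exact (ih.mono (F.mono n.le_succ)).add (hDm n)
  have hN2 (n : ℕ) : MemLp (N n) 2 P := memLp_finsetSum _ fun i _ => hD2 i
  have hint (n : ℕ) : Integrable (N n) P := (hN2 n).integrable one_le_two
  have hDint (n : ℕ) : Integrable (D n) P := (hD2 n).integrable one_le_two
  have hmart : Martingale N F P := by
    refine martingale_of_condExp_sub_eq_zero_nat hNm hint fun n => ?_
    rw [hNs, add_sub_cancel_left]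
    exact hD0 n
  have horth (n : ℕ) : ∫ ω, N n ω * D n ω ∂P = 0 := by
    have h1 := condExp_mul_of_stronglyMeasurable_left (hNm n)
      ((hN2 n).integrable_mul (hD2 n)) (hDint n)
    calc ∫ ω, N n ω * D n ω ∂P = ∫ ω, (P[N n * D n | F n]) ω ∂P :=
          (integral_condExp (F.le n)).symm
      _ = ∫ _, (0 : ℝ) ∂P := integral_congr_ae (by
          filter_upwards [h1, hD0 n] with ω e1 e2
          rw [e1, Pi.mul_apply, e2]; simp)
      _ = 0 := by simp
  have hsq (n : ℕ) : ∫ ω, N n ω ^ 2 ∂P = ∑ i ∈ Finset.range n, ∫ ω, D i ω ^ 2 ∂P := by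
    induction n with
    | zero => simp [hN]
    | succ n ih =>
      rw [Finset.sum_range_succ, ← ih]
      have e : (fun ω => N (n + 1) ω ^ 2) =
          fun ω => (N n ω ^ 2 + D n ω ^ 2) + 2 * (N n ω * D n ω) := by
        ext ω; rw [hNs, Pi.add_apply]; ring
      have i1 : Integrable (fun ω => N n ω ^ 2 + D n ω ^ 2) P :=
        (hN2 n).integrable_sq.add (hD2 n).integrable_sq
      have i2 : Integrable (fun ω => N n ω * D n ω) P := (hN2 n).integrable_mul (hD2 n)
      rw [e, integral_add i1 (i2.const_mul 2), integral_add (hN2 n).integrable_sq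
        (hD2 n).integrable_sq, integral_const_mul, horth]
      ring
  have hbound (n : ℕ) : eLpNorm (N n) 1 P ≤
      ((1 + ∑' i, ∫ ω, D i ω ^ 2 ∂P).toNNReal : ℝ≥0∞) := by
    rw [eLpNorm_one_eq_lintegral_enorm, ← ofReal_integral_norm_eq_lintegral_enorm (hint n)]
    refine ENNReal.ofReal_le_ofReal ?_
    calc ∫ ω, ‖N n ω‖ ∂P ≤ ∫ ω, (1 + N n ω ^ 2) ∂P := by
          refine integral_mono (hint n).norm ((integrable_const 1).add (hN2 n).integrable_sq)
            fun ω => ?_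
          rw [Real.norm_eq_abs]
          change |N n ω| ≤ 1 + N n ω ^ 2
          nlinarith [sq_abs (N n ω), sq_nonneg (|N n ω| - 1), abs_nonneg (N n ω)]
      _ = 1 + ∑ i ∈ Finset.range n, ∫ ω, D i ω ^ 2 ∂P := by
          rw [integral_add (integrable_const 1) (hN2 n).integrable_sq, hsq]; simp
      _ ≤ _ := by
          gcongr
          exact hsum.sum_le_tsum _ fun i _ => integral_nonneg fun ω => sq_nonneg _
  exact hmart.submartingale.exists_ae_tendsto_of_bdd hbound

lemma integral_sub_condExp_sq_le {Ω : Type*} {m m0 : MeasurableSpace Ω} {P : Measure Ω}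
    [IsProbabilityMeasure P] (hm : m ≤ m0) {Z : Ω → ℝ} (hZ : MemLp Z 2 P) :
    ∫ ω, (Z ω - (P[Z | m]) ω) ^ 2 ∂P ≤ ∫ ω, Z ω ^ 2 ∂P := by
  have h1 := integral_condVar_add_variance_condExp hm hZ
  have h2 : ∫ ω, (Var[Z; P | m]) ω ∂P = ∫ ω, (Z ω - (P[Z | m]) ω) ^ 2 ∂P :=
    integral_condExp hm
  have h3 := variance_nonneg (P[Z | m]) P
  have h4 := variance_le_expectation_sq hZ.1
  simp only [Pi.pow_apply] at h4
  linarith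

/-! ### The model and its history -/

/-- The standing assumptions on the memory sequence `μ`, the recollection probability `p`, the
innovations `ξ`, the recollection indicators `α` and the recalled epochs `β`. -/
structure IsReinforcementModel {Ω : Type*} [MeasurableSpace Ω] (P : Measure Ω) (μ : ℕ → ℝ)
    (p : ℝ) (ξ α : ℕ → Ω → ℝ) (β : ℕ → Ω → ℕ) : Prop where
  pos : ∀ n, 1 ≤ n → 0 < μ n
  p_nonneg : 0 ≤ p
  p_lt_one : p < 1
  measurable_ξ : ∀ n, Measurable (ξ (n + 1))
  iIndepFun_ξ : iIndepFun (fun n => ξ (n + 1)) P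
  identDistrib_ξ : ∀ n, IdentDistrib (ξ (n + 1)) (ξ 1) P P
  measurable_α : ∀ n, Measurable (α (n + 2))
  iIndepFun_α : iIndepFun (fun n => α (n + 2)) P
  measure_α_one : ∀ n, P {ω | α (n + 2) ω = 1} = ENNReal.ofReal p
  measure_α_zero : ∀ n, P {ω | α (n + 2) ω = 0} = ENNReal.ofReal (1 - p)
  measurable_β : ∀ n, Measurable (β (n + 2))
  iIndepFun_β : iIndepFun (fun n => β (n + 2)) P
  measure_β : ∀ n, 2 ≤ n → ∀ k, 1 ≤ k → k ≤ n - 1 →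
    P {ω | β n ω = k} = ENNReal.ofReal (μ k / ∑ j ∈ Finset.Icc 1 (n - 1), μ j)
  indepFun_α_β : IndepFun (fun ω n => α (n + 2) ω) (fun ω n => β (n + 2) ω) P
  indepFun_ξ_αβ : IndepFun (fun ω n => ξ (n + 1) ω)
    (fun ω => ((fun n => α (n + 2) ω, fun n => β (n + 2) ω) : (ℕ → ℝ) × (ℕ → ℕ))) P

/-- The random step `X n`. -/
abbrev randomStep {Ω : Type*} (ξ α : ℕ → Ω → ℝ) (β : ℕ → Ω → ℕ) (n : ℕ) (ω : Ω) : ℝ :=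
  reinforcedStep (fun k => ξ k ω) (fun k => α k ω) (fun k => β k ω) n

/-- The σ-algebras of the single innovations, indicators and recalled epochs, in one family. -/
@[reducible] def sourceσ {Ω : Type*} (ξ α : ℕ → Ω → ℝ) (β : ℕ → Ω → ℕ) :
    ℕ ⊕ (ℕ ⊕ ℕ) → MeasurableSpace Ω :=
  Sum.elim (fun n => MeasurableSpace.comap (ξ (n + 1)) inferInstance)
    (Sum.elim (fun n => MeasurableSpace.comap (α (n + 2)) inferInstance)
      fun n => MeasurableSpace.comap (β (n + 2)) inferInstance)

/-- The epoch of the walk at which a source of randomness is used. -/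
def sourceEpoch : ℕ ⊕ (ℕ ⊕ ℕ) → ℕ := Sum.elim (· + 1) (Sum.elim (· + 2) (· + 2))

lemma reinforcedStep_add_two (ξ α : ℕ → ℝ) (β : ℕ → ℕ) (n : ℕ) :
    reinforcedStep ξ α β (n + 2) = α (n + 2) * (∑ i ∈ Finset.range (n + 2),
      if β (n + 2) = i then reinforcedStep ξ α β i else 0) + (1 - α (n + 2)) * ξ (n + 2) := by
  rw [reinforcedStep, Finset.sum_ite_eq]
  simp

lemma measurable_reinforcedStep {Ω : Type*} {m : MeasurableSpace Ω} {ξ α : ℕ → Ω → ℝ}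
    {β : ℕ → Ω → ℕ} {N : ℕ} (hξ : ∀ n, n + 1 ≤ N → Measurable (ξ (n + 1)))
    (hα : ∀ n, n + 2 ≤ N → Measurable (α (n + 2))) (hβ : ∀ n, n + 2 ≤ N → Measurable (β (n + 2)))
    (n : ℕ) (hn : n ≤ N) : Measurable (randomStep ξ α β n) := by
  induction n using Nat.strong_induction_on with
  | _ n ih =>
    match n, ih, hn with
    | 0, _, _ =>
      have : randomStep ξ α β 0 = fun _ => 0 := by ext ω; rw [randomStep, reinforcedStep]
      rw [this]; exact measurable_const
    | 1, _, hn =>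
      have : randomStep ξ α β 1 = ξ 1 := by ext ω; rw [randomStep, reinforcedStep]
      rw [this]; exact hξ 0 hn
    | n + 2, ih, hn =>
      have : randomStep ξ α β (n + 2) = fun ω => α (n + 2) ω * (∑ i ∈ Finset.range (n + 2),
          if β (n + 2) ω = i then randomStep ξ α β i ω else 0) +
          (1 - α (n + 2) ω) * ξ (n + 2) ω := by
        ext ω; exact reinforcedStep_add_two _ _ _ _
      rw [this]
      refine ((hα n hn).mul (Finset.measurable_fun_sum _ fun i hi => ?_)).add
        ((measurable_const.sub (hα n hn)).mul (hξ (n + 1) hn))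
      have hi' := Finset.mem_range.1 hi
      exact Measurable.ite (hβ n hn (measurableSet_singleton i)) (ih i hi' (by omega))
        measurable_const

namespace IsReinforcementModel

variable {Ω : Type*} [m0 : MeasurableSpace Ω] {P : Measure Ω} {μ : ℕ → ℝ} {p : ℝ}
  {ξ α : ℕ → Ω → ℝ} {β : ℕ → Ω → ℕ}

lemma sourceσ_le (h : IsReinforcementModel P μ p ξ α β) (i : ℕ ⊕ (ℕ ⊕ ℕ)) :
    sourceσ ξ α β i ≤ m0 := by
  rcases i with n | n | n
  · exact (h.measurable_ξ n).comap_le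
  · exact (h.measurable_α n).comap_le
  · exact (h.measurable_β n).comap_le

lemma iIndep_sourceσ (h : IsReinforcementModel P μ p ξ α β) : iIndep (sourceσ ξ α β) P := by
  refine iIndep_sumElim h.iIndepFun_ξ (iIndep_sumElim h.iIndepFun_α h.iIndepFun_β ?_) ?_
  · exact indep_of_indep_of_le_left (indep_of_indep_of_le_right h.indepFun_α_β
      (iSup_comap_le_comap_pi _)) (iSup_comap_le_comap_pi _)
  · refine indep_of_indep_of_le_left (indep_of_indep_of_le_right h.indepFun_ξ_αβ ?_)
      (iSup_comap_le_comap_pi _)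
    refine iSup_le fun j => ?_
    rcases j with n | n
    · rintro _ ⟨s, hs, rfl⟩
      exact ⟨_, ((measurable_pi_apply n).comp measurable_fst) hs, rfl⟩
    · rintro _ ⟨s, hs, rfl⟩
      exact ⟨_, ((measurable_pi_apply n).comp measurable_snd) hs, rfl⟩

/-- The history of the walk: what has been used up to a given epoch. -/
def history (h : IsReinforcementModel P μ p ξ α β) : Filtration ℕ m0 where
  seq n := ⨆ i ∈ {i | sourceEpoch i ≤ n}, sourceσ ξ α β i
  mono' _ _ hmn := biSup_mono fun _ hi => le_trans hi hmn
  le' _ := iSup₂_le fun i _ => h.sourceσ_le i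

/-- The σ-algebra of what is used at a given epoch. -/
@[reducible] def fresh (_ : IsReinforcementModel P μ p ξ α β) (n : ℕ) : MeasurableSpace Ω :=
  ⨆ i ∈ {i | sourceEpoch i = n}, sourceσ ξ α β i

lemma fresh_le (h : IsReinforcementModel P μ p ξ α β) (n : ℕ) : h.fresh n ≤ m0 :=
  iSup₂_le fun i _ => h.sourceσ_le i

lemma indep_fresh_history (h : IsReinforcementModel P μ p ξ α β) (n : ℕ) :
    Indep (h.fresh (n + 1)) (h.history n) P := by
  refine indep_iSup_of_disjoint h.sourceσ_le h.iIndep_sourceσ ?_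
  rw [Set.disjoint_left]
  intro i (hi : sourceEpoch i = n + 1) (hi' : sourceEpoch i ≤ n)
  omega

lemma fresh_measurable_ξ (h : IsReinforcementModel P μ p ξ α β) (n : ℕ) :
    Measurable[h.fresh (n + 1)] (ξ (n + 1)) :=
  Measurable.of_comap_le (le_iSup₂_of_le (f := fun i (_ : i ∈ {i | sourceEpoch i = n + 1}) =>
    sourceσ ξ α β i) (Sum.inl n) rfl le_rfl)

lemma fresh_measurable_α (h : IsReinforcementModel P μ p ξ α β) (n : ℕ) :
    Measurable[h.fresh (n + 2)] (α (n + 2)) :=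
  Measurable.of_comap_le (le_iSup₂_of_le (f := fun i (_ : i ∈ {i | sourceEpoch i = n + 2}) =>
    sourceσ ξ α β i) (Sum.inr (Sum.inl n)) rfl le_rfl)

lemma fresh_measurable_β (h : IsReinforcementModel P μ p ξ α β) (n : ℕ) :
    Measurable[h.fresh (n + 2)] (β (n + 2)) :=
  Measurable.of_comap_le (le_iSup₂_of_le (f := fun i (_ : i ∈ {i | sourceEpoch i = n + 2}) =>
    sourceσ ξ α β i) (Sum.inr (Sum.inr n)) rfl le_rfl)

lemma fresh_le_history (h : IsReinforcementModel P μ p ξ α β) {m n : ℕ} (hmn : m ≤ n) :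
    h.fresh m ≤ h.history n :=
  biSup_mono fun i (hi : sourceEpoch i = m) => (hi.le.trans hmn : sourceEpoch i ≤ n)

lemma history_measurable_step (h : IsReinforcementModel P μ p ξ α β) {n N : ℕ} (hn : n ≤ N) :
    Measurable[h.history N] (randomStep ξ α β n) :=
  @measurable_reinforcedStep _ (h.history N) _ _ _ N
    (fun _ hk => (h.fresh_measurable_ξ _).mono (h.fresh_le_history hk) le_rfl)
    (fun _ hk => (h.fresh_measurable_α _).mono (h.fresh_le_history hk) le_rfl)
    (fun _ hk => (h.fresh_measurable_β _).mono (h.fresh_le_history hk) le_rfl) n hn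

lemma measurable_step (h : IsReinforcementModel P μ p ξ α β) (n : ℕ) :
    Measurable (randomStep ξ α β n) :=
  (h.history_measurable_step le_rfl).mono (h.history.le n) le_rfl

/-! ### The conditional law of a step given the past -/

lemma sum_pos (h : IsReinforcementModel P μ p ξ α β) (n : ℕ) :
    0 < ∑ j ∈ Finset.Icc 1 (n + 1), μ j :=
  Finset.sum_pos (fun j hj => h.pos j (Finset.mem_Icc.1 hj).1) ⟨1, by simp⟩

/-- The event that the step of epoch `n` repeats the one of epoch `i`. -/
def repeatSet (α : ℕ → Ω → ℝ) (β : ℕ → Ω → ℕ) (n i : ℕ) : Set Ω :=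
  {ω | α n ω = 1} ∩ {ω | β n ω = i}

lemma measureReal_repeatSet (h : IsReinforcementModel P μ p ξ α β) {n i : ℕ}
    (hi : i ∈ Finset.Icc 1 (n + 1)) : P.real (repeatSet α β (n + 2) i) =
      p * (μ i / ∑ j ∈ Finset.Icc 1 (n + 1), μ j) := by
  have hi' := Finset.mem_Icc.1 hi
  have hind : IndepFun (α (n + 2)) (β (n + 2)) P :=
    h.indepFun_α_β.comp (measurable_pi_apply n) (measurable_pi_apply n)
  have h1 := hind.measure_inter_preimage_eq_mul {1} {i} (measurableSet_singleton _)
    (measurableSet_singleton _)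
  have h2 : P (repeatSet α β (n + 2) i) = ENNReal.ofReal p *
      ENNReal.ofReal (μ i / ∑ j ∈ Finset.Icc 1 (n + 1), μ j) := by
    have hb : P {ω | β (n + 2) ω = i} =
        ENNReal.ofReal (μ i / ∑ j ∈ Finset.Icc 1 (n + 1), μ j) :=
      h.measure_β (n + 2) (by omega) i hi'.1 hi'.2
    rw [← h.measure_α_one n, ← hb]
    exact h1
  rw [measureReal_def, h2, ENNReal.toReal_mul, ENNReal.toReal_ofReal h.p_nonneg,
    ENNReal.toReal_ofReal (div_nonneg (h.pos i hi'.1).le (h.sum_pos n).le)]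

lemma integral_innovation (h : IsReinforcementModel P μ p ξ α β) {f : ℝ → ℝ} (hf : Measurable f)
    (n : ℕ) : ∫ ω, {ω | α (n + 2) ω = 0}.indicator (fun ω => f (ξ (n + 2) ω)) ω ∂P =
      (1 - p) * ∫ ω, f (ξ 1 ω) ∂P := by
  have hind : IndepFun (α (n + 2)) (ξ (n + 2)) P :=
    h.indepFun_ξ_αβ.symm.comp ((measurable_pi_apply n).comp measurable_fst)
      (measurable_pi_apply (n + 1))
  have hg : Measurable (({0} : Set ℝ).indicator (1 : ℝ → ℝ)) :=
    measurable_one.indicator (measurableSet_singleton 0)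
  have h1 := (hind.comp hg hf).integral_fun_mul_eq_mul_integral
    (hg.comp (h.measurable_α n)).aestronglyMeasurable
    (hf.comp (h.measurable_ξ (n + 1))).aestronglyMeasurable
  have h2 : ∫ ω, (({0} : Set ℝ).indicator (1 : ℝ → ℝ) ∘ α (n + 2)) ω ∂P = 1 - p := by
    have h0 : MeasurableSet {ω | α (n + 2) ω = 0} :=
      h.measurable_α n (measurableSet_singleton 0)
    have : ({0} : Set ℝ).indicator (1 : ℝ → ℝ) ∘ α (n + 2) =
        {ω | α (n + 2) ω = 0}.indicator 1 := rfl
    rw [this, integral_indicator_one h0, measureReal_def, h.measure_α_zero,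
      ENNReal.toReal_ofReal (by linarith [h.p_lt_one])]
  have h3 : ∫ ω, (f ∘ ξ (n + 2)) ω ∂P = ∫ ω, f (ξ 1 ω) ∂P :=
    ((h.identDistrib_ξ (n + 1)).comp hf).integral_eq
  rw [h2, h3] at h1
  rw [← h1]
  refine integral_congr_ae (.of_forall fun ω => ?_)
  by_cases h0 : α (n + 2) ω = 0 <;> simp [h0]

variable [IsProbabilityMeasure P]

lemma ae_α (h : IsReinforcementModel P μ p ξ α β) (n : ℕ) :
    ∀ᵐ ω ∂P, α (n + 2) ω = 1 ∨ α (n + 2) ω = 0 := by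
  have h1 : MeasurableSet {ω | α (n + 2) ω = 1} := h.measurable_α n (measurableSet_singleton 1)
  have h0 : MeasurableSet {ω | α (n + 2) ω = 0} := h.measurable_α n (measurableSet_singleton 0)
  change {ω | α (n + 2) ω = 1} ∪ {ω | α (n + 2) ω = 0} ∈ ae P
  rw [mem_ae_iff_prob_eq_one (h1.union h0), measure_union _ h0, h.measure_α_one, h.measure_α_zero,
    ← ENNReal.ofReal_add h.p_nonneg (by linarith [h.p_lt_one])]
  · simp
  · rw [Set.disjoint_left]
    intro ω (h1 : _ = _) (h0 : _ = _)
    rw [h1] at h0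
    exact one_ne_zero h0

lemma ae_β (h : IsReinforcementModel P μ p ξ α β) (n : ℕ) :
    ∀ᵐ ω ∂P, β (n + 2) ω ∈ Finset.Icc 1 (n + 1) := by
  have hm (i : ℕ) : MeasurableSet {ω | β (n + 2) ω = i} :=
    h.measurable_β n (measurableSet_singleton i)
  have hset : {ω | β (n + 2) ω ∈ Finset.Icc 1 (n + 1)} =
      ⋃ i ∈ Finset.Icc 1 (n + 1), {ω | β (n + 2) ω = i} := by
    ext ω; simp
  change {ω | β (n + 2) ω ∈ Finset.Icc 1 (n + 1)} ∈ ae P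
  rw [hset, mem_ae_iff_prob_eq_one (Finset.measurableSet_biUnion _ fun i _ => hm i),
    measure_biUnion_finset _ fun i _ => hm i]
  · have hM := h.sum_pos n
    calc ∑ i ∈ Finset.Icc 1 (n + 1), P {ω | β (n + 2) ω = i}
        = ∑ i ∈ Finset.Icc 1 (n + 1), ENNReal.ofReal (μ i / ∑ j ∈ Finset.Icc 1 (n + 1), μ j) :=
          Finset.sum_congr rfl fun i hi =>
            h.measure_β (n + 2) (by omega) i (Finset.mem_Icc.1 hi).1 (Finset.mem_Icc.1 hi).2
      _ = ENNReal.ofReal (∑ i ∈ Finset.Icc 1 (n + 1), μ i / ∑ j ∈ Finset.Icc 1 (n + 1), μ j) :=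
          (ENNReal.ofReal_sum_of_nonneg fun i hi =>
            div_nonneg (h.pos i (Finset.mem_Icc.1 hi).1).le hM.le).symm
      _ = 1 := by rw [← Finset.sum_div, div_self hM.ne', ENNReal.ofReal_one]
  · intro i _ j _ hij
    rw [Function.onFun, Set.disjoint_left]
    intro ω (hi : _ = _) (hj : _ = _)
    exact hij (hi.symm.trans hj)

lemma ae_comp_step (h : IsReinforcementModel P μ p ξ α β) (f : ℝ → ℝ) (n : ℕ) :
    (fun ω => f (randomStep ξ α β (n + 2) ω)) =ᵐ[P]
      (∑ i ∈ Finset.Icc 1 (n + 1), (fun ω => f (randomStep ξ α β i ω)) *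
        (repeatSet α β (n + 2) i).indicator 1) +
      {ω | α (n + 2) ω = 0}.indicator fun ω => f (ξ (n + 2) ω) := by
  filter_upwards [h.ae_α n, h.ae_β n] with ω hα hβ
  have hβ' := Finset.mem_Icc.1 hβ
  have hstep : randomStep ξ α β (n + 2) ω = α (n + 2) ω *
      randomStep ξ α β (β (n + 2) ω) ω + (1 - α (n + 2) ω) * ξ (n + 2) ω := by
    rw [randomStep, reinforcedStep, dif_pos (by omega)]
  rw [hstep]
  simp only [Pi.add_apply, Finset.sum_apply, Pi.mul_apply, repeatSet, Set.indicator_apply,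
    Set.mem_inter_iff, Set.mem_ofPred_eq, Pi.one_apply]
  rcases hα with hα | hα
  · simp only [hα, true_and, mul_ite, mul_one, mul_zero, Finset.sum_ite_eq, if_pos hβ,
      one_ne_zero, if_false]
    simp
  · simp [hα]

/-- Given the past, a step repeats the one of epoch `i` with probability `p * μ i / M` and is a new
innovation with probability `1 - p`. -/
lemma condExp_comp_step (h : IsReinforcementModel P μ p ξ α β) {f : ℝ → ℝ} (hf : Measurable f)
    {B : ℝ} (hB : ∀ x, |f x| ≤ B) (n : ℕ) :
    P[fun ω => f (randomStep ξ α β (n + 2) ω) | h.history (n + 1)] =ᵐ[P] fun ω =>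
      (∑ i ∈ Finset.Icc 1 (n + 1), f (randomStep ξ α β i ω) *
        (p * (μ i / ∑ j ∈ Finset.Icc 1 (n + 1), μ j))) + (1 - p) * ∫ ω, f (ξ 1 ω) ∂P := by
  have hFle : h.history (n + 1) ≤ m0 := h.history.le _
  have hGle : h.fresh (n + 2) ≤ m0 := h.fresh_le _
  have hind : Indep (h.fresh (n + 2)) (h.history (n + 1)) P := h.indep_fresh_history (n + 1)
  have hEm (i : ℕ) : MeasurableSet[h.fresh (n + 2)] (repeatSet α β (n + 2) i) :=
    MeasurableSet.inter (h.fresh_measurable_α n (measurableSet_singleton 1))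
      (h.fresh_measurable_β n (measurableSet_singleton i))
  have h0m : MeasurableSet[h.fresh (n + 2)] {ω | α (n + 2) ω = 0} :=
    h.fresh_measurable_α n (measurableSet_singleton 0)
  have hgm : Measurable[h.fresh (n + 2)] ({ω | α (n + 2) ω = 0}.indicator fun ω => f (ξ (n + 2) ω)) :=
    (hf.comp (h.fresh_measurable_ξ (n + 1))).indicator h0m
  have hEint (i : ℕ) : Integrable ((repeatSet α β (n + 2) i).indicator (1 : Ω → ℝ)) P :=
    (integrable_const 1).indicator (hGle _ (hEm i))
  have hfm (i : ℕ) : Measurable fun ω => f (randomStep ξ α β i ω) := hf.comp (h.measurable_step i)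
  have hprod (i : ℕ) : Integrable ((fun ω => f (randomStep ξ α β i ω)) *
      (repeatSet α β (n + 2) i).indicator (1 : Ω → ℝ)) P :=
    (hEint i).bdd_mul (c := B) (hfm i).aestronglyMeasurable (.of_forall fun ω => hB _)
  have hgint : Integrable ({ω | α (n + 2) ω = 0}.indicator fun ω => f (ξ (n + 2) ω)) P :=
    (Integrable.of_bound (hf.comp (h.measurable_ξ (n + 1))).aestronglyMeasurable B
      (.of_forall fun ω => hB _)).indicator (hGle _ h0m)
  have hterm (i : ℕ) (hi : i ∈ Finset.Icc 1 (n + 1)) :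
      P[(fun ω => f (randomStep ξ α β i ω)) *
        (repeatSet α β (n + 2) i).indicator (1 : Ω → ℝ) | h.history (n + 1)] =ᵐ[P]
      fun ω => f (randomStep ξ α β i ω) * (p * (μ i / ∑ j ∈ Finset.Icc 1 (n + 1), μ j)) := by
    have hXm : Measurable[h.history (n + 1)] fun ω => f (randomStep ξ α β i ω) :=
      hf.comp (h.history_measurable_step (Finset.mem_Icc.1 hi).2)
    have e1 := condExp_mul_of_stronglyMeasurable_left hXm.stronglyMeasurable (hprod i) (hEint i)
    have hEs : StronglyMeasurable[h.fresh (n + 2)]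
        ((repeatSet α β (n + 2) i).indicator (1 : Ω → ℝ)) :=
      stronglyMeasurable_const.indicator (hEm i)
    have e2 := condExp_indep_eq hGle hFle hEs hind
    filter_upwards [e1, e2] with ω h1 h2
    rw [h1, Pi.mul_apply, h2, integral_indicator_one (hGle _ (hEm i)),
      h.measureReal_repeatSet hi]
  have hnew := condExp_indep_eq hGle hFle hgm.stronglyMeasurable hind
  have hall : ∀ᵐ ω ∂P, ∀ i ∈ Finset.Icc 1 (n + 1),
      (P[(fun ω => f (randomStep ξ α β i ω)) *
        (repeatSet α β (n + 2) i).indicator (1 : Ω → ℝ) | h.history (n + 1)]) ω =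
      f (randomStep ξ α β i ω) * (p * (μ i / ∑ j ∈ Finset.Icc 1 (n + 1), μ j)) :=
    (Finset.eventually_all _).2 hterm
  filter_upwards [condExp_congr_ae (m := h.history (n + 1)) (h.ae_comp_step f n),
    condExp_add (integrable_finsetSum' _ fun i _ => hprod i) hgint (h.history (n + 1)),
    condExp_finsetSum (fun i _ => hprod i) (h.history (n + 1)), hnew, hall] with ω e1 e2 e3 e4 e5
  rw [e1, e2, Pi.add_apply, e3, e4, Finset.sum_apply, Finset.sum_congr rfl e5,
    h.integral_innovation hf n]

/-- Every step has the law of the innovations. -/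
lemma integral_comp_step (h : IsReinforcementModel P μ p ξ α β) {f : ℝ → ℝ} (hf : Measurable f)
    {B : ℝ} (hB : ∀ x, |f x| ≤ B) (n : ℕ) :
    ∫ ω, f (randomStep ξ α β (n + 1) ω) ∂P = ∫ ω, f (ξ 1 ω) ∂P := by
  induction n using Nat.strong_induction_on with
  | _ n ih =>
    rcases n with _ | n
    · simp only [randomStep, reinforcedStep, zero_add]
    · have hint (i : ℕ) : Integrable (fun ω => f (randomStep ξ α β i ω)) P :=
        Integrable.of_bound (hf.comp (h.measurable_step i)).aestronglyMeasurable B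
          (.of_forall fun ω => hB _)
      rw [← integral_condExp (h.history.le (n + 1)),
        integral_congr_ae (h.condExp_comp_step hf hB n),
        integral_add (integrable_finsetSum _ fun i _ => (hint i).mul_const _) (integrable_const _),
        integral_finsetSum _ fun i _ => (hint i).mul_const _]
      have e : ∀ i ∈ Finset.Icc 1 (n + 1), ∫ ω, f (randomStep ξ α β i ω) *
          (p * (μ i / ∑ j ∈ Finset.Icc 1 (n + 1), μ j)) ∂P =
          (p * ∫ ω, f (ξ 1 ω) ∂P) * (μ i / ∑ j ∈ Finset.Icc 1 (n + 1), μ j) := by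
        intro i hi
        obtain ⟨k, rfl⟩ : ∃ k, i = k + 1 := ⟨i - 1, by have := Finset.mem_Icc.1 hi; omega⟩
        rw [integral_mul_const, ih k (by have := Finset.mem_Icc.1 hi; omega)]
        ring
      rw [Finset.sum_congr rfl e, ← Finset.mul_sum, ← Finset.sum_div, div_self (h.sum_pos n).ne']
      simp
      ring

lemma identDistrib_step (h : IsReinforcementModel P μ p ξ α β) (n : ℕ) :
    IdentDistrib (randomStep ξ α β (n + 1)) (ξ 1) P P where
  aemeasurable_fst := (h.measurable_step _).aemeasurable
  aemeasurable_snd := (h.measurable_ξ 0).aemeasurable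
  map_eq := by
    ext s hs
    rw [Measure.map_apply (h.measurable_step _) hs, Measure.map_apply (h.measurable_ξ 0) hs]
    have hs' : Measurable (s.indicator (1 : ℝ → ℝ)) := measurable_one.indicator hs
    have h1 := h.integral_comp_step hs' (B := 1) (fun x => by
      by_cases hx : x ∈ s <;> simp [hx]) n
    have e1 : (fun ω => s.indicator (1 : ℝ → ℝ) (randomStep ξ α β (n + 1) ω)) =
      (randomStep ξ α β (n + 1) ⁻¹' s).indicator 1 := rfl
    have e2 : (fun ω => s.indicator (1 : ℝ → ℝ) (ξ 1 ω)) = (ξ 1 ⁻¹' s).indicator 1 := rfl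
    rw [e1, e2, integral_indicator_one (h.measurable_step _ hs),
      integral_indicator_one (h.measurable_ξ 0 hs)] at h1
    exact (measureReal_eq_measureReal_iff).1 h1

end IsReinforcementModel

/-! ### Truncation -/

/-- For integrable `Z` the second moments of the truncations of `Z` at level `j`, divided by `j ^ 2`,
are summable. -/
lemma summable_integral_truncation_sq {Ω : Type*} [MeasurableSpace Ω] {P : Measure Ω}
    [IsProbabilityMeasure P] {Z : Ω → ℝ} (hZ : Integrable Z P) :
    Summable fun n : ℕ => (((n : ℝ) + 1) ^ 2)⁻¹ * ∫ ω, truncation Z ((n : ℝ) + 1) ω ^ 2 ∂P := by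
  let _ : MeasureSpace Ω := ⟨P⟩
  have habs := sum_variance_truncation_le (X := fun ω => |Z ω|) hZ.abs (fun ω => abs_nonneg _)
  have hle (A : ℝ) : ∫ ω, truncation Z A ω ^ 2 ∂P ≤
      ∫ ω, (truncation (fun ω => |Z ω|) A ^ 2 : Ω → ℝ) ω ∂P := by
    refine integral_mono (hZ.1.memLp_truncation (p := 2)).integrable_sq
      (hZ.abs.1.memLp_truncation (p := 2)).integrable_sq fun ω => ?_
    by_cases hA : Z ω ∈ Set.Ioc (-A) A
    · rcases le_or_gt A 0 with hA0 | hA0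
      · have := hA.1.trans_le hA.2
        exact absurd this (by linarith)
      · have h2 : |Z ω| ∈ Set.Ioc (-A) A :=
          ⟨by linarith [abs_nonneg (Z ω)], abs_le.2 ⟨hA.1.le, hA.2⟩⟩
        simp [truncation, hA, h2]
    · have : truncation Z A ω = 0 := by simp [truncation, hA]
      change truncation Z A ω ^ 2 ≤ truncation (fun ω => |Z ω|) A ω ^ 2
      rw [this, zero_pow two_ne_zero]
      exact sq_nonneg _
  have hnn : ∀ n : ℕ, 0 ≤ (((n : ℝ) + 1) ^ 2)⁻¹ *
      ∫ ω, (truncation (fun ω => |Z ω|) ((n : ℝ) + 1) ^ 2 : Ω → ℝ) ω ∂P := fun n =>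
    mul_nonneg (by positivity) (integral_nonneg fun ω => by simp only [Pi.pow_apply]; positivity)
  refine Summable.of_nonneg_of_le
    (fun n => mul_nonneg (by positivity) (integral_nonneg fun ω => sq_nonneg _))
    (fun n => mul_le_mul_of_nonneg_left (hle _) (by positivity)) ?_
  refine summable_of_sum_range_le hnn (c := 2 * ∫ ω, |Z ω| ∂P) fun n => ?_
  have h := habs (n + 1)
  simp only [Finset.sum_range_succ', Nat.cast_add, Nat.cast_one, Nat.cast_zero, ne_eq,
    OfNat.ofNat_ne_zero, not_false_eq_true, zero_pow, inv_zero, zero_mul, add_zero] at h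
  exact h

namespace IsReinforcementModel

variable {Ω : Type*} [m0 : MeasurableSpace Ω] {P : Measure Ω} {μ : ℕ → ℝ} {p : ℝ}
  {ξ α : ℕ → Ω → ℝ} {β : ℕ → Ω → ℕ} [IsProbabilityMeasure P]

/-! ### The strong law of large numbers for the walk -/

/-- The step of epoch `n + 1`, truncated at level `n + 1`. -/
def truncatedStep (ξ α : ℕ → Ω → ℝ) (β : ℕ → Ω → ℕ) (n : ℕ) : Ω → ℝ :=
  truncation (randomStep ξ α β (n + 1)) ((n : ℝ) + 1)

/-- The truncated step of epoch `n + 1`, centred by its conditional mean given the past. -/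
def noise (h : IsReinforcementModel P μ p ξ α β) (n : ℕ) : Ω → ℝ :=
  truncatedStep ξ α β n - P[truncatedStep ξ α β n | h.history n]

omit [IsProbabilityMeasure P] in
lemma measurable_truncatedStep (h : IsReinforcementModel P μ p ξ α β) (n : ℕ) :
    Measurable[h.history (n + 1)] (truncatedStep ξ α β n) :=
  (measurable_id.indicator measurableSet_Ioc).comp (h.history_measurable_step le_rfl)

lemma memLp_truncatedStep (h : IsReinforcementModel P μ p ξ α β) (n : ℕ) :
    MemLp (truncatedStep ξ α β n) 2 P :=
  (h.measurable_step (n + 1)).aestronglyMeasurable.memLp_truncation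

/-- By comparison with the second moments of the truncated innovations, the noise series with
weights `O(1 / n)` converge almost surely. -/
lemma ae_tendsto_sum_noise (h : IsReinforcementModel P μ p ξ α β) (hξ : Integrable (ξ 1) P)
    {w : ℕ → ℝ} {C : ℝ} (hw : ∀ n, |w n| ≤ C / ((n : ℝ) + 1)) :
    ∀ᵐ ω ∂P, ∃ R, Tendsto (fun n => ∑ i ∈ Finset.range n, w i * h.noise i ω) atTop (𝓝 R) := by
  have hint (n : ℕ) : Integrable (truncatedStep ξ α β n) P :=
    (h.memLp_truncatedStep n).integrable one_le_two
  have hN2 (n : ℕ) : MemLp (h.noise n) 2 P :=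
    (h.memLp_truncatedStep n).sub ((h.memLp_truncatedStep n).condExp one_le_two)
  refine ae_tendsto_sum_of_condExp_eq_zero (F := h.history) (D := fun n ω => w n * h.noise n ω)
    (fun n => ?_) (fun n => (hN2 n).const_mul (w n)) (fun n => ?_) ?_
  · exact ((h.measurable_truncatedStep n).stronglyMeasurable.sub
      (stronglyMeasurable_condExp.mono (h.history.mono n.le_succ))).const_mul (w n)
  · have e1 := condExp_smul (μ := P) (w n) (h.noise n) (h.history n)
    have e2 := condExp_sub (hint n) (integrable_condExp (f := truncatedStep ξ α β n)
      (m := h.history n)) (h.history n)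
    have e3 := condExp_of_stronglyMeasurable (h.history.le n)
      (stronglyMeasurable_condExp (f := truncatedStep ξ α β n) (m := h.history n) (μ := P))
      integrable_condExp
    filter_upwards [e1, e2] with ω h1 h2
    refine h1.trans ?_
    rw [Pi.smul_apply, noise, h2, Pi.sub_apply, e3, sub_self, smul_zero, Pi.zero_apply]
  · refine Summable.of_nonneg_of_le (fun n => integral_nonneg fun ω => sq_nonneg _) (fun n => ?_)
      ((summable_integral_truncation_sq hξ).mul_left (C ^ 2))
    have e1 : ∫ ω, h.noise n ω ^ 2 ∂P ≤ ∫ ω, truncatedStep ξ α β n ω ^ 2 ∂P :=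
      integral_sub_condExp_sq_le (h.history.le n) (h.memLp_truncatedStep n)
    have e2 : ∫ ω, truncatedStep ξ α β n ω ^ 2 ∂P =
        ∫ ω, truncation (ξ 1) ((n : ℝ) + 1) ω ^ 2 ∂P :=
      ((h.identDistrib_step n).truncation.comp (measurable_id.pow_const 2)).integral_eq
    have e3 : w n ^ 2 ≤ C ^ 2 * (((n : ℝ) + 1) ^ 2)⁻¹ := by
      rw [← sq_abs, ← div_eq_mul_inv, ← div_pow]
      exact pow_le_pow_left₀ (abs_nonneg _) (hw n) 2
    simp only [mul_pow]
    rw [integral_const_mul, ← mul_assoc, ← e2]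
    refine mul_le_mul e3 e1 (integral_nonneg fun ω => sq_nonneg _) (by positivity)

/-- By the Borel–Cantelli lemma the truncation is eventually not felt. -/
lemma ae_eventually_abs_step_le (h : IsReinforcementModel P μ p ξ α β)
    (hξ : Integrable (ξ 1) P) :
    ∀ᵐ ω ∂P, ∀ᶠ n : ℕ in atTop, |randomStep ξ α β (n + 1) ω| ≤ n := by
  have hsum : ∑' n : ℕ, P {ω | |randomStep ξ α β (n + 1) ω| ∈ Set.Ioi (n : ℝ)} ≠ ∞ := by
    have e (n : ℕ) : P {ω | |randomStep ξ α β (n + 1) ω| ∈ Set.Ioi (n : ℝ)} =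
        P {ω | |ξ 1 ω| ∈ Set.Ioi (n : ℝ)} :=
      ((h.identDistrib_step n).comp measurable_abs).measure_mem_eq measurableSet_Ioi
    simp only [e]
    let _ : MeasureSpace Ω := ⟨P⟩
    exact (tsum_prob_mem_Ioi_lt_top (X := fun ω => |ξ 1 ω|) hξ.abs fun ω => abs_nonneg _).ne
  filter_upwards [ae_eventually_notMem hsum] with ω hω
  filter_upwards [hω] with n hn
  simpa using hn

lemma ae_tendsto_walk_div (h : IsReinforcementModel P μ p ξ α β) (hξ : Integrable (ξ 1) P)
    (hmean : ∫ ω, ξ 1 ω ∂P = 0) {C : ℝ}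
    (hC : ∀ n : ℕ, 1 ≤ n → n * μ n ≤ C * ∑ j ∈ Finset.Icc 1 n, μ j)
    (hdiv : Tendsto (fun n => ∑ j ∈ Finset.range n, μ (j + 1)) atTop atTop) :
    ∀ᵐ ω ∂P, Tendsto (fun n : ℕ => reinforcedWalk (fun k => ξ k ω) (fun k => α k ω)
      (fun k => β k ω) n / n) atTop (𝓝 0) := by
  have hw (n : ℕ) : |μ (n + 1) / ∑ j ∈ Finset.Icc 1 (n + 1), μ j| ≤ C / ((n : ℝ) + 1) := by
    rw [abs_of_pos (div_pos (h.pos _ (by omega)) (h.sum_pos n)),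
      div_le_div_iff₀ (h.sum_pos n) (by positivity)]
    have := hC (n + 1) (by omega)
    push_cast at this
    linarith
  have hw' (n : ℕ) : |1 / ((n : ℝ) + 1)| ≤ 1 / ((n : ℝ) + 1) := (abs_of_pos (by positivity)).le
  have hcond : ∀ᵐ ω ∂P, ∀ n : ℕ, (P[truncatedStep ξ α β (n + 1) | h.history (n + 1)]) ω =
      (∑ i ∈ Finset.Icc 1 (n + 1), truncation (randomStep ξ α β i) ((n + 1 : ℕ) + 1 : ℝ) ω *
        (p * (μ i / ∑ j ∈ Finset.Icc 1 (n + 1), μ j))) +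
      (1 - p) * ∫ ω, truncation (ξ 1) ((n + 1 : ℕ) + 1 : ℝ) ω ∂P :=
    ae_all_iff.2 fun n => h.condExp_comp_step
      (f := (Set.Ioc (-((n + 1 : ℕ) + 1 : ℝ)) ((n + 1 : ℕ) + 1 : ℝ)).indicator id)
      (measurable_id.indicator measurableSet_Ioc)
      (fun x => abs_truncation_le_bound (fun x => x) ((n + 1 : ℕ) + 1 : ℝ) x) n
  have hmean0 : Tendsto (fun n : ℕ => (1 - p) * ∫ ω, truncation (ξ 1) ((n : ℝ) + 1) ω ∂P)
      atTop (𝓝 0) := by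
    have h1 := (tendsto_integral_truncation hξ).comp
      (tendsto_atTop_add_const_right _ (1 : ℝ) (tendsto_natCast_atTop_atTop (R := ℝ)))
    rw [hmean] at h1
    simpa using h1.const_mul (1 - p)
  filter_upwards [h.ae_tendsto_sum_noise hξ hw, h.ae_tendsto_sum_noise hξ hw', hcond,
    h.ae_eventually_abs_step_le hξ] with ω ⟨R, hR⟩ ⟨R', hR'⟩ hcω hbω
  refine tendsto_average_zero_of_reinforcement (x := fun n => randomStep ξ α β n ω)
    h.p_nonneg h.p_lt_one h.pos hdiv hR hR' (hmean0.congr' ?_)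
  obtain ⟨N, hN⟩ := eventually_atTop.1 hbω
  -- From some epoch on, neither the new step nor any earlier one exceeds the truncation level.
  filter_upwards [eventually_ge_atTop (N + 1),
    eventually_ge_atTop ⌈∑ i ∈ Finset.range (N + 1), |randomStep ξ α β i ω|⌉₊] with m hm1 hm2
  obtain ⟨n, rfl⟩ : ∃ n, m = n + 1 := ⟨m - 1, by omega⟩
  have htr (i : ℕ) (hi : i ∈ Finset.Icc 1 (n + 2)) :
      truncation (randomStep ξ α β i) ((n + 1 : ℕ) + 1 : ℝ) ω = randomStep ξ α β i ω := by
    have hi' := Finset.mem_Icc.1 hi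
    refine truncation_eq_self ?_
    rcases le_or_gt i N with hiN | hiN
    · have h1 : |randomStep ξ α β i ω| ≤ ∑ i ∈ Finset.range (N + 1), |randomStep ξ α β i ω| :=
        Finset.single_le_sum (f := fun i => |randomStep ξ α β i ω|) (fun _ _ => abs_nonneg _)
          (Finset.mem_range.2 (by omega))
      have h2 := Nat.ceil_le.1 hm2
      linarith
    · obtain ⟨k, rfl⟩ : ∃ k, i = k + 1 := ⟨i - 1, by omega⟩
      have h1 := hN k (by omega)
      have h2 : (k : ℝ) ≤ (n + 1 : ℕ) := by exact_mod_cast (by omega : k ≤ n + 1)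
      linarith
  have hnoise : h.noise (n + 1) ω = randomStep ξ α β (n + 2) ω -
      (P[truncatedStep ξ α β (n + 1) | h.history (n + 1)]) ω := by
    rw [noise, Pi.sub_apply, truncatedStep, htr (n + 2) (by simp)]
  rw [hnoise, hcω n]
  have hsum : ∑ i ∈ Finset.Icc 1 (n + 1),
      truncation (randomStep ξ α β i) ((n + 1 : ℕ) + 1 : ℝ) ω *
        (p * (μ i / ∑ j ∈ Finset.Icc 1 (n + 1), μ j)) =
      p * ((∑ j ∈ Finset.Icc 1 (n + 1), μ j * randomStep ξ α β j ω) /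
        ∑ j ∈ Finset.Icc 1 (n + 1), μ j) := by
    rw [Finset.sum_div, Finset.mul_sum]
    refine Finset.sum_congr rfl fun i hi => ?_
    rw [htr i (by have := Finset.mem_Icc.1 hi; exact Finset.mem_Icc.2 (by omega))]
    ring
  rw [hsum]
  ring

/-! ### Convergence in mean -/

omit [IsProbabilityMeasure P] in
lemma measurable_walk (h : IsReinforcementModel P μ p ξ α β) : Measurable fun ω =>
    reinforcedWalk (fun k => ξ k ω) (fun k => α k ω) (fun k => β k ω) :=
  measurable_pi_lambda _ fun _ => Finset.measurable_fun_sum _ fun i _ => h.measurable_step i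

/-- The running maximum of the walk is dominated by an average of identically distributed absolute
steps, which is uniformly integrable in `L^r`; hence almost sure convergence implies convergence
in `L^r`. -/
lemma tendsto_eLpNorm_runningMax (h : IsReinforcementModel P μ p ξ α β)
    (hlln : ∀ᵐ ω ∂P, Tendsto (fun n : ℕ => reinforcedWalk (fun k => ξ k ω) (fun k => α k ω)
      (fun k => β k ω) n / n) atTop (𝓝 0))
    {r : ℝ≥0∞} (hr : 1 ≤ r) (hr' : r ≠ ∞) (hξ : MemLp (ξ 1) r P) (T : ℝ≥0) :
    Tendsto (fun n : ℕ => eLpNorm (fun ω => runningMax (reinforcedWalk (fun k => ξ k ω)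
      (fun k => α k ω) (fun k => β k ω)) ⌊(n : ℝ≥0) * T⌋₊ / n) r P) atTop (𝓝 0) := by
  set G : ℕ → Ω → ℝ := fun n ω => runningMax (reinforcedWalk (fun k => ξ k ω)
      (fun k => α k ω) (fun k => β k ω)) ⌊(n : ℝ≥0) * T⌋₊ / n with hG
  set K := ⌈T⌉₊ with hK
  -- The factor `K` compensates for averaging over `n * K` steps instead of `n`.
  set f : ℕ → Ω → ℝ := fun i ω => K * |randomStep ξ α β (i + 1) ω| with hf
  have hGm (n : ℕ) : Measurable (G n) := by
    refine Measurable.div_const ?_ _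
    have : Measurable fun s : ℕ → ℝ => runningMax s ⌊(n : ℝ≥0) * T⌋₊ :=
      Finset.measurable_range_sup'' fun m _ => (measurable_pi_apply m).abs
    exact this.comp h.measurable_walk
  have hfid (i : ℕ) : IdentDistrib (f i) (f 0) P P :=
    ((h.identDistrib_step i).trans (h.identDistrib_step 0).symm).comp
      (measurable_abs.const_mul (K : ℝ))
  have hf0 : MemLp (f 0) r P := by
    have : MemLp (randomStep ξ α β (0 + 1)) r P := (h.identDistrib_step 0).memLp_iff.2 hξ
    exact this.abs.const_mul (K : ℝ)
  have hUI := uniformIntegrable_average_real hr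
    (MemLp.uniformIntegrable_of_identDistrib (j := 0) hr hr' hf0 hfid)
  have hdom (n : ℕ) (ω : Ω) :
      |G n ω| ≤ |((∑ i ∈ Finset.range (n * K), f i) / ((n * K : ℕ) : Ω → ℝ)) ω| := by
    rw [abs_of_nonneg (div_nonneg (runningMax_nonneg _ _) (Nat.cast_nonneg n))]
    refine le_trans ?_ (le_abs_self _)
    have hfl : ⌊(n : ℝ≥0) * T⌋₊ ≤ n * K := by
      refine Nat.floor_le_of_le ?_
      push_cast
      gcongr
      exact Nat.le_ceil T
    have hmax : runningMax (reinforcedWalk (fun k => ξ k ω) (fun k => α k ω) (fun k => β k ω))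
        ⌊(n : ℝ≥0) * T⌋₊ ≤ ∑ i ∈ Finset.range (n * K), |randomStep ξ α β (i + 1) ω| := by
      refine runningMax_le fun m hm => ?_
      rw [reinforcedWalk, sum_Icc_one_eq_sum_range]
      refine (Finset.abs_sum_le_sum_abs _ _).trans ?_
      exact Finset.sum_le_sum_of_subset_of_nonneg
        (Finset.range_subset_range.2 (hm.trans hfl)) fun _ _ _ => abs_nonneg _
    simp only [Pi.div_apply, Finset.sum_apply, hf, ← Finset.mul_sum, Pi.natCast_apply]
    rcases Nat.eq_zero_or_pos n with rfl | hn
    · simp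
    have hn' : (0 : ℝ) < n := by exact_mod_cast hn
    rcases Nat.eq_zero_or_pos K with hK0 | hK0
    · rw [hK0] at hmax ⊢
      simp only [mul_zero, Finset.range_zero, Finset.sum_empty] at hmax
      simp only [CharP.cast_eq_zero, zero_mul, zero_div]
      exact div_nonpos_of_nonpos_of_nonneg hmax hn'.le
    · have hK' : (0 : ℝ) < K := by exact_mod_cast hK0
      calc _ ≤ (∑ i ∈ Finset.range (n * K), |randomStep ξ α β (i + 1) ω|) / (n : ℝ) := by gcongr
        _ = _ := by push_cast; field_simp
  have hGUI : UnifIntegrable G r P := by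
    intro ε hε
    obtain ⟨δ, hδ, H⟩ := hUI.2.1 hε
    refine ⟨δ, hδ, fun n s hs hPs => (eLpNorm_mono fun ω => ?_).trans (H (n * K) s hs hPs)⟩
    by_cases hω : ω ∈ s
    · simpa only [Set.indicator_of_mem hω, Real.norm_eq_abs] using hdom n ω
    · simp [hω]
  have hlim := tendsto_Lp_finite_of_tendsto_ae hr hr' (g := fun _ => 0)
    (fun n => (hGm n).aestronglyMeasurable) MemLp.zero' hGUI (by
      filter_upwards [hlln] with ω hω
      exact tendsto_runningMax_div hω T)
  refine hlim.congr fun n => ?_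
  congr 1
  ext ω
  simp [hG]

/-- Convergence to the zero path in `L^r`, for the Skorohod metric and uniformly on compact time
intervals. -/
lemma tendsto_eLpNorm_rescaledPath (h : IsReinforcementModel P μ p ξ α β)
    (hlln : ∀ᵐ ω ∂P, Tendsto (fun n : ℕ => reinforcedWalk (fun k => ξ k ω) (fun k => α k ω)
      (fun k => β k ω) n / n) atTop (𝓝 0))
    {r : ℝ≥0∞} (hr : 1 ≤ r) (hr' : r ≠ ∞) (hξ : MemLp (ξ 1) r P) {Y : ℕ → Ω → SkorohodSpace}
    (hY : ∀ n ω, Y n ω = SkorohodSpace.rescaledPath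
      (reinforcedWalk (fun k => ξ k ω) (fun k => α k ω) (fun k => β k ω)) n) :
    Tendsto (fun n => eLpNorm (fun ω => SkorohodSpace.skorohodDist (Y n ω) 0) r P)
        atTop (𝓝 0) ∧
      ∀ T : ℝ≥0, Tendsto (fun n => eLpNorm (fun ω => SkorohodSpace.uniformEDist T (Y n ω) 0) r P)
        atTop (𝓝 0) := by
  have hmax := h.tendsto_eLpNorm_runningMax hlln hr hr' hξ
  constructor
  · refine tendsto_order.2 ⟨fun b hb => absurd hb not_lt_zero, fun ε hε => ?_⟩
    obtain ⟨M, hM⟩ : ∃ M : ℕ, ENNReal.ofReal ((1 / 2) ^ M) < ε / 2 := by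
      have : Tendsto (fun M : ℕ => ENNReal.ofReal ((1 / 2) ^ M)) atTop (𝓝 0) := by
        simpa using ENNReal.tendsto_ofReal
          (tendsto_pow_atTop_nhds_zero_of_lt_one (by norm_num : (0 : ℝ) ≤ 1 / 2) (by norm_num))
      exact (this.eventually (gt_mem_nhds (ENNReal.half_pos hε.ne'))).exists
    filter_upwards [(hmax M).eventually (gt_mem_nhds (ENNReal.half_pos hε.ne'))] with n hn
    calc eLpNorm (fun ω => SkorohodSpace.skorohodDist (Y n ω) 0) r P
        ≤ eLpNorm ((fun ω => runningMax (reinforcedWalk (fun k => ξ k ω) (fun k => α k ω)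
            (fun k => β k ω)) ⌊(n : ℝ≥0) * (M : ℝ≥0)⌋₊ / n) + fun _ => (1 / 2 : ℝ) ^ M) r P := by
          refine eLpNorm_mono_real fun ω => ?_
          rw [Real.norm_of_nonneg (SkorohodSpace.skorohodDist_nonneg _ _), hY]
          exact SkorohodSpace.skorohodDist_rescaledPath_le _ n M
      _ ≤ _ := eLpNorm_add_le ?_ aestronglyMeasurable_const hr
      _ < ε / 2 + ε / 2 := by
          refine ENNReal.add_lt_add hn ?_
          rw [eLpNorm_const _ (by positivity) (NeZero.ne P)]
          simpa [Real.enorm_eq_ofReal_abs] using hM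
      _ = ε := ENNReal.add_halves ε
    have : Measurable fun s : ℕ → ℝ => runningMax s ⌊(n : ℝ≥0) * (M : ℝ≥0)⌋₊ :=
      Finset.measurable_range_sup'' fun m _ => (measurable_pi_apply m).abs
    exact ((this.comp h.measurable_walk).div_const _).aestronglyMeasurable
  · intro T
    refine tendsto_of_tendsto_of_tendsto_of_le_of_le tendsto_const_nhds (hmax T)
      (fun _ => zero_le) fun n => eLpNorm_mono_enorm fun ω => ?_
    rw [enorm_eq_self, hY, Real.enorm_of_nonneg
      (div_nonneg (runningMax_nonneg _ _) (Nat.cast_nonneg n))]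
    exact SkorohodSpace.uniformEDist_rescaledPath_le _ n T

end IsReinforcementModel

end

theorem mainTheorem5
    {Ω : Type*} [MeasurableSpace Ω] (P : Measure Ω) [IsProbabilityMeasure P]
    -- parameters: memory sequence, its index, recollection probability
    (μ : ℕ → ℝ) (γ : ℝ) (hγ : -1 < γ) (hμ : IsRegularlyVarying μ γ)
    (p : ℝ) (hp0 : 0 ≤ p) (hp1 : p < 1)
    -- innovations `ξ n`, `n ≥ 1`: i.i.d. with zero mean
    (ξ : ℕ → Ω → ℝ) (hξ_meas : ∀ n, Measurable (ξ (n + 1)))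
    (hξ_indep : iIndepFun (fun n => ξ (n + 1)) P)
    (hξ_ident : ∀ n, IdentDistrib (ξ (n + 1)) (ξ 1) P P)
    (hξ_int : Integrable (ξ 1) P) (hξ_mean : ∫ ω, ξ 1 ω ∂P = 0)
    -- recollection indicators `α n`, `n ≥ 2`: i.i.d. Bernoulli with parameter `p`
    (α : ℕ → Ω → ℝ) (hα_meas : ∀ n, Measurable (α (n + 2)))
    (hα_indep : iIndepFun (fun n => α (n + 2)) P)
    (hα_one : ∀ n, P {ω | α (n + 2) ω = 1} = ENNReal.ofReal p)
    (hα_zero : ∀ n, P {ω | α (n + 2) ω = 0} = ENNReal.ofReal (1 - p))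
    -- recalled epochs `β n`, `n ≥ 2`: independent, `β n = k` with probability proportional to `μ k`
    (β : ℕ → Ω → ℕ) (hβ_meas : ∀ n, Measurable (β (n + 2)))
    (hβ_indep : iIndepFun (fun n => β (n + 2)) P)
    (hβ_law : ∀ n, 2 ≤ n → ∀ k, 1 ≤ k → k ≤ n - 1 →
      P {ω | β n ω = k} = ENNReal.ofReal (μ k / ∑ j ∈ Finset.Icc 1 (n - 1), μ j))
    -- the three sequences are mutually independent
    (hαβ : IndepFun (fun ω n => α (n + 2) ω) (fun ω n => β (n + 2) ω) P)
    (hξαβ : IndepFun (fun ω n => ξ (n + 1) ω)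
      (fun ω => ((fun n => α (n + 2) ω, fun n => β (n + 2) ω) : (ℕ → ℝ) × (ℕ → ℕ))) P)
    -- the processes `t ↦ S ⌊n t⌋ / n`
    (Y : ℕ → Ω → SkorohodSpace)
    (hY : ∀ n ω, Y n ω = SkorohodSpace.rescaledPath
      (reinforcedWalk (fun k => ξ k ω) (fun k => α k ω) (fun k => β k ω)) n) :
    -- they are random elements of `D([0,∞))` with its Borel σ-field
    (∀ n, Measurable (Y n)) ∧
    -- almost sure convergence in the Skorohod topology
    (∀ᵐ ω ∂P, Tendsto (fun n => Y n ω) atTop (𝓝 0)) ∧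
    -- convergence in `L¹`, for the Skorohod metric and uniformly on compact time intervals
    (Tendsto (fun n => eLpNorm (fun ω => SkorohodSpace.skorohodDist (Y n ω) 0) 1 P)
        atTop (𝓝 0) ∧
      ∀ T : ℝ≥0, Tendsto (fun n => eLpNorm (fun ω => SkorohodSpace.uniformEDist T (Y n ω) 0) 1 P)
        atTop (𝓝 0)) ∧
    -- convergence in `L²` if the innovations have finite variance
    (MemLp (ξ 1) 2 P →
      Tendsto (fun n => eLpNorm (fun ω => SkorohodSpace.skorohodDist (Y n ω) 0) 2 P)
        atTop (𝓝 0) ∧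
      ∀ T : ℝ≥0, Tendsto (fun n => eLpNorm (fun ω => SkorohodSpace.uniformEDist T (Y n ω) 0) 2 P)
        atTop (𝓝 0)) := by
  have hmodel : IsReinforcementModel P μ p ξ α β :=
    ⟨hμ.1, hp0, hp1, hξ_meas, hξ_indep, hξ_ident, hα_meas, hα_indep, hα_one, hα_zero, hβ_meas,
      hβ_indep, hβ_law, hαβ, hξαβ⟩
  obtain ⟨C, hC⟩ := hμ.exists_mul_le_sum
  have hlln := hmodel.ae_tendsto_walk_div hξ_int hξ_mean hC (hμ.tendsto_sum_atTop hγ)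
  refine ⟨fun n => ?_, ?_, ?_, fun hξ2 => ?_⟩
  · have : Y n = fun ω => SkorohodSpace.rescaledPath (reinforcedWalk (fun k => ξ k ω)
        (fun k => α k ω) (fun k => β k ω)) n := funext (hY n)
    rw [this]
    exact (SkorohodSpace.measurable_rescaledPath n).comp hmodel.measurable_walk
  · filter_upwards [hlln] with ω hω
    simpa only [hY] using SkorohodSpace.tendsto_rescaledPath hω
  · exact hmodel.tendsto_eLpNorm_rescaledPath hlln le_rfl ENNReal.one_ne_top
      (memLp_one_iff_integrable.2 hξ_int) hY
  · exact hmodel.tendsto_eLpNorm_rescaledPath hlln one_le_two ENNReal.ofNat_ne_top hξ2 hY
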